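/- Let $H$ and $G_1,\dots,G_m$ be finite-dimensional real Hilbert spaces. Let $f:H\to\mathbb R$ be convex and differentiable with $L$-Lipschitz gradient, $L>0$. Let $g\in\Gamma_0(H)$ and $h_i\in\Gamma_0(G_i)$ (proper lower semicontinuous convex functions with values in $(-\infty,+\infty]$), and let $B_i:H\to G_i$ be linear, $i=1,\dots,m$. Consider $$\min_{x\in H}\ f(x)+g(x)+\sum_{i=1}^m h_i(B_ix),\qquad (1.1)$$ and assume that (1.1) has a solution (a minimizer with finite value). Let $w_i>0$ with $\sum_{i=1}^m w_i=1$, $\gamma\in(0,2/L)$, and $\sigma,\tau>0$ with $\sigma\tau\sum_{i=1}^m w_i\|B_i\|^2<1$. Write $\mathrm{prox}_{cF}(v)=\arg\min_z\{\tfrac12\|z-v\|^2+cF(z)\}$, and let $h_i^*$ be the Fenchel conjugate of $h_i$. For $u\in H$, the inner problem is $$\min_{x\in H}\ P_u(x)=\tfrac12\|x-u\|^2+\gamma g(x)+\gamma\sum_{i=1}^m h_i(B_ix).$$ On $\mathbf G=G_1\times\dots\times G_m$ with the inner product $\sum_i w_i\langle y_i,z_i\rangle$, its dual function is $$D_u(y)=\inf_{x\in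 H}\Big\{\tfrac12\|x-u\|^2+\gamma g(x)+\sum_i w_i\langle B_ix,y_i\rangle\Big\}-\gamma\sum_i h_i^*\big(\tfrac{w_i}{\gamma}y_i\big),$$ and its primal-dual gap at $(x,y)$ is $P_u(x)-D_u(y)$. The inner iteration for $u$ is $$\bar x^{j+1}=\mathrm{prox}_{\frac{\tau\gamma}{1+\tau}g}\Big(\frac{\bar x^{j}-\tau\sum_i w_iB_i^*y_i^{j}+\tau u}{1+\tau}\Big),\qquad y_i^{j+1}=\frac{\gamma}{w_i}\,\mathrm{prox}_{\frac{w_i\sigma}{\gamma}h_i^*}\Big(\frac{w_i}{\gamma}\big(y_i^{j}+\sigma B_i(2\bar x^{j+1}-\bar x^{j})\big)\Big).$$ (a) For every $u\in H$ for which the inner problem has a primal-dual solution (a pair with zero gap), and for every starting point, the inner iterates $(\bar x^j,y^j)$ converge, as $j\to\infty$, to a pair with zero gap. (b) Let $\varepsilon_k\ge0$ with $\sum_k\sqrt{\varepsilon_k}<\infty$, and let $x^0,\bar x^0\in H$, $y^0\in\mathbf G$ be arbitrary. Let $(x^k)$ be generated as follows, for $k=0,1,2,\dots$. Put $u^k=x^k-\gamma\nabla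 f(x^k)$. Run the inner iteration for $u=u^k$, from $(\bar x^0,y^0)$ if $k=0$ and from an arbitrary point if $k\ge1$ (for example $(\bar x^0,y^0)$ again, or the last inner iterate of the preceding step). Then either end it after an iteration whose result $(\bar x^{j+1},y^{j+1})$ has gap less than $\varepsilon_k$ and put $x^{k+1}=\bar x^{j+1}$; or run it forever, in which case its primal iterates are supposed to converge, and $x^{k+1}=\lim_j\bar x^{j}$. Then $(x^k)$ converges to a solution of (1.1). -/

import Mathlib

open Filter Topology
open scoped RealInnerProductSpace Gradient

/-- The class `Γ₀(E)`: proper, lower semicontinuous, convex functions `E → (-∞, +∞]`.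
Convexity is convexity of the epigraph. -/
structure IsGammaZero {E : Type*} [NormedAddCommGroup E] [NormedSpace ℝ E]
    (F : E → EReal) : Prop where
  ne_bot : ∀ x, F x ≠ ⊥
  exists_ne_top : ∃ x, F x ≠ ⊤
  lsc : LowerSemicontinuous F
  convex : Convex ℝ {p : E × ℝ | F p.1 ≤ (p.2 : EReal)}

/-- `IsProx c F u x` says `x = prox_{c F}(u)`, i.e. `x` is a minimizer of
`z ↦ ½ ‖z - u‖² + c F(z)` (unique when `F ∈ Γ₀(E)` and `c > 0`). -/
def IsProx {E : Type*} [NormedAddCommGroup E] (c : ℝ) (F : E → EReal) (u x : E) : Prop :=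
  ∀ z, ((‖x - u‖ ^ 2 / 2 : ℝ) : EReal) + (c : EReal) * F x
    ≤ ((‖z - u‖ ^ 2 / 2 : ℝ) : EReal) + (c : EReal) * F z

/-- The Fenchel conjugate `F^*(y) = sup_x ⟨x, y⟩ - F(x)`. -/
noncomputable def fenchelConj {E : Type*} [NormedAddCommGroup E] [InnerProductSpace ℝ E]
    (F : E → EReal) (y : E) : EReal :=
  ⨆ x, ((⟪x, y⟫ : ℝ) : EReal) - F x

section Composite

variable {m : ℕ} {H : Type*} [NormedAddCommGroup H] [InnerProductSpace ℝ H] [CompleteSpace H]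
  {G : Fin m → Type*} [∀ i, NormedAddCommGroup (G i)] [∀ i, InnerProductSpace ℝ (G i)]
  [∀ i, CompleteSpace (G i)]

/-- The objective `f(x) + g(x) + ∑ᵢ hᵢ(Bᵢ x)`. -/
noncomputable def compositeObjective (f : H → ℝ) (g : H → EReal) (h : ∀ i, G i → EReal)
    (B : ∀ i, H →L[ℝ] G i) (x : H) : EReal :=
  (f x : EReal) + g x + ∑ i, h i (B i x)

/-- A solution of `min_x f(x) + g(x) + ∑ᵢ hᵢ(Bᵢ x)`: a minimizer with finite value. -/
def IsCompositeSolution (f : H → ℝ) (g : H → EReal) (h : ∀ i, G i → EReal)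
    (B : ∀ i, H →L[ℝ] G i) (x : H) : Prop :=
  compositeObjective f g h B x ≠ ⊤ ∧
    ∀ z, compositeObjective f g h B x ≤ compositeObjective f g h B z

/-- Primal value of the inner problem `min_x ½ ‖x - u‖² + γ g(x) + γ ∑ᵢ hᵢ(Bᵢ x)`. -/
noncomputable def innerPrimal (g : H → EReal) (h : ∀ i, G i → EReal) (B : ∀ i, H →L[ℝ] G i)
    (γ : ℝ) (u x : H) : EReal :=
  ((‖x - u‖ ^ 2 / 2 : ℝ) : EReal) + (γ : EReal) * g x + (γ : EReal) * ∑ i, h i (B i x)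

/-- Dual value of the inner problem at `y ∈ G₁ × ⋯ × G_m`, where the product carries the weighted
inner product `∑ᵢ wᵢ ⟨yᵢ, zᵢ⟩`: the infimum over `x` of the Lagrangian
`½ ‖x - u‖² + γ g(x) + ∑ᵢ wᵢ ⟨Bᵢ x, yᵢ⟩ - γ ∑ᵢ hᵢ^*(wᵢ yᵢ / γ)`. -/
noncomputable def innerDual (g : H → EReal) (h : ∀ i, G i → EReal) (B : ∀ i, H →L[ℝ] G i)
    (w : Fin m → ℝ) (γ : ℝ) (u : H) (y : ∀ i, G i) : EReal :=
  (⨅ x, ((‖x - u‖ ^ 2 / 2 + ∑ i, w i * ⟪B i x, y i⟫ : ℝ) : EReal) + (γ : EReal) * g x)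
    - (γ : EReal) * ∑ i, fenchelConj (h i) ((w i / γ) • y i)

/-- The primal-dual gap of the inner problem. -/
noncomputable def innerGap (g : H → EReal) (h : ∀ i, G i → EReal) (B : ∀ i, H →L[ℝ] G i)
    (w : Fin m → ℝ) (γ : ℝ) (u x : H) (y : ∀ i, G i) : EReal :=
  innerPrimal g h B γ u x - innerDual g h B w γ u y

/-- One inner (primal-dual) iteration `(x̄, y) ↦ (x̄', y')`:
`x̄' = prox_{(τγ/(1+τ)) g}((x̄ - τ ∑ᵢ wᵢ Bᵢ^* yᵢ + τ u) / (1 + τ))`,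
`yᵢ' = (γ/wᵢ) prox_{(wᵢσ/γ) hᵢ^*}((wᵢ/γ) (yᵢ + σ Bᵢ (2 x̄' - x̄)))`. -/
def IsInnerStep (g : H → EReal) (h : ∀ i, G i → EReal) (B : ∀ i, H →L[ℝ] G i)
    (w : Fin m → ℝ) (γ σ τ : ℝ) (u xb : H) (y : ∀ i, G i) (xb' : H) (y' : ∀ i, G i) : Prop :=
  IsProx (τ * γ / (1 + τ)) g
      ((1 + τ)⁻¹ • (xb - τ • ∑ i, w i • (B i).adjoint (y i) + τ • u)) xb' ∧
    ∀ i, ∃ q : G i,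
      IsProx (w i * σ / γ) (fenchelConj (h i))
        ((w i / γ) • (y i + σ • B i ((2 : ℝ) • xb' - xb))) q ∧
      y' i = (γ / w i) • q

/-- The sequences `x^k`, `u^k`, `x̄^{k,j}`, `y^{k,j}` are generated by the primal-dual
forward-backward splitting algorithm with initial data `x0`, `xb0`, `y0` and inner tolerances `ε k`.
Each inner loop may be started anywhere (for instance at the initial `xb0, y0`, or at
the last inner iterate of the preceding outer step); the first one starts at `xb0, y0`.
The `k`-th inner loop is ended after an iteration whose primal-dual gap is less than `ε k`, and its
last primal iterate is `x^{k+1}`; or it is run forever, and then `x^{k+1}` is the limit of its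
primal iterates. For every `k` the inner iterates are recorded for all `j`, also
beyond the iteration at which the loop is ended. -/
structure IsPrimalDualFBRun (f : H → ℝ) (g : H → EReal) (h : ∀ i, G i → EReal)
    (B : ∀ i, H →L[ℝ] G i) (w : Fin m → ℝ) (γ σ τ : ℝ) (ε : ℕ → ℝ)
    (x0 xb0 : H) (y0 : ∀ i, G i)
    (x u : ℕ → H) (xb : ℕ → ℕ → H) (y : ℕ → ℕ → ∀ i, G i) : Prop where
  x_zero : x 0 = x0
  xb_zero : xb 0 0 = xb0
  y_zero : y 0 0 = y0
  gradient_step : ∀ k, u k = x k - γ • ∇ f (x k)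
  inner_step : ∀ k j,
    IsInnerStep g h B w γ σ τ (u k) (xb k j) (y k j) (xb k (j + 1)) (y k (j + 1))
  output : ∀ k,
    (∃ j, innerGap g h B w γ (u k) (xb k (j + 1)) (y k (j + 1)) < (ε k : EReal) ∧
      x (k + 1) = xb k (j + 1)) ∨
    Tendsto (xb k) atTop (𝓝 (x (k + 1)))

end Composite

/-! The inner iteration is a proximal point method and the outer one an inexact forward-backward
method; both converge by Fejér monotonicity in a finite-dimensional space.

Inner loop. The extrapolation `2 x̄' - x̄` makes one step an implicit step for the saddle function
(the Lagrangian) in the metric `primalDualForm`, which the condition on `σ τ` makes positive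
definite. Tested at a point `(z, η)`, the step bounds the metric product of the increment with `(z,
η) - (x', y')` by `Lagr(z, y') - Lagr(x', η)` (`IsInnerStep.exists_primalDualForm_le`). At a
zero-gap pair this difference is nonpositive, so the squared distance to the pair decreases by at
least the squared increment. Increments vanish, cluster points are saddle points, and Fenchel-Moreau
turns a saddle point into a pair with zero gap.

Outer loop. With `Φ = g + ∑ hᵢ ∘ Bᵢ` treated as one function of class `Γ₀`, solutions are the fixed
points of `T = prox_{γΦ} ∘ (id - γ ∇f)`, with no qualification condition. Baillon-Haddad
cocoercivity and firm nonexpansiveness make `T` nonexpansive with a quantitative surplus, so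
summable errors do not destroy convergence. An inner loop stopped at gap below `ε` has error at most
`√(2 ε)` by strong convexity. One run forever has error zero once its primal iterates converge: were
the limit not optimal, the squared distance to some fixed primal-dual point would decrease by a
fixed amount at every late step. This needs no dual solution. -/

section ExtendedReal

/-! ### Extended-real arithmetic. -/

lemma EReal.exists_coe_eq {a : EReal} (hb : a ≠ ⊥) (ht : a ≠ ⊤) : ∃ r : ℝ, a = r :=
  ⟨a.toReal, (EReal.coe_toReal ht hb).symm⟩

lemma EReal.exists_coe_lt {a : EReal} (hb : a ≠ ⊥) : ∃ r : ℝ, (r : EReal) < a :=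
  (EReal.lt_iff_exists_real_btwn.1 (bot_lt_iff_ne_bot.2 hb)).imp fun _ h => h.2

lemma EReal.coe_finsetSum {ι : Type*} (s : Finset ι) (a : ι → ℝ) :
    ((∑ i ∈ s, a i : ℝ) : EReal) = ∑ i ∈ s, (a i : EReal) := by
  classical
  induction s using Finset.induction_on with
  | empty => simp
  | insert i s hi ih => rw [Finset.sum_insert hi, Finset.sum_insert hi, EReal.coe_add, ih]

lemma EReal.finsetSum_ne_bot {ι : Type*} (s : Finset ι) {a : ι → EReal} (h : ∀ i, a i ≠ ⊥) :
    ∑ i ∈ s, a i ≠ ⊥ := by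
  classical
  induction s using Finset.induction_on with
  | empty => simp
  | insert i s hi ih =>
    rw [Finset.sum_insert hi]
    exact EReal.add_ne_bot_iff.2 ⟨h i, ih⟩

lemma EReal.finsetSum_ne_top {ι : Type*} {s : Finset ι} {a : ι → EReal} (h : ∀ i, a i ≠ ⊥)
    (hs : ∑ i ∈ s, a i ≠ ⊤) : ∀ i ∈ s, a i ≠ ⊤ := by
  classical
  induction s using Finset.induction_on with
  | empty => simp
  | insert i s hi ih =>
    rw [Finset.sum_insert hi] at hs
    rw [EReal.add_ne_top_iff_ne_top₂ (h i) (EReal.finsetSum_ne_bot s h)] at hs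
    intro j hj
    rcases Finset.mem_insert.1 hj with rfl | hj
    · exact hs.1
    · exact ih hs.2 j hj

lemma EReal.coe_mul_ne_bot {c : ℝ} (hc : 0 < c) {a : EReal} (h : a ≠ ⊥) : (c : EReal) * a ≠ ⊥ := by
  induction a with
  | bot => exact absurd rfl h
  | top => rw [EReal.coe_mul_top_of_pos hc]; simp
  | coe r => rw [← EReal.coe_mul]; exact EReal.coe_ne_bot _

lemma EReal.coe_mul_ne_top {c : ℝ} (hc : 0 < c) {a : EReal} (h : (c : EReal) * a ≠ ⊤) : a ≠ ⊤ := by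
  rintro rfl
  exact h (EReal.coe_mul_top_of_pos hc)

/-- A finite family of extended reals all of whose real minorants have sum at most `M`
is real-valued with sum at most `M`. -/
lemma EReal.exists_coe_sum_le {ι : Type*} [Fintype ι] {c : ι → EReal} (hc : ∀ i, c i ≠ ⊥) {M : ℝ}
    (hM : ∀ a : ι → ℝ, (∀ i, (a i : EReal) < c i) → ∑ i, a i ≤ M) :
    ∃ t : ι → ℝ, (∀ i, c i = t i) ∧ ∑ i, t i ≤ M := by
  classical
  choose a ha using fun i => EReal.exists_coe_lt (hc i)
  have htop : ∀ i, c i ≠ ⊤ := by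
    intro i hi
    -- An infinite entry could be raised until the sum of minorants equals `M + 1`.
    have := hM (Function.update a i (a i + (M - ∑ j, a j) + 1)) (by
      intro j
      rcases eq_or_ne j i with rfl | hj
      · rw [hi]; exact EReal.coe_lt_top _
      · simpa [hj] using ha j)
    rw [Finset.sum_update_of_mem (Finset.mem_univ i), ← Finset.erase_eq] at this
    have h2 := Finset.add_sum_erase Finset.univ a (Finset.mem_univ i)
    linarith
  choose t ht using fun i => EReal.exists_coe_eq (hc i) (htop i)
  refine ⟨t, ht, le_of_forall_pos_le_add fun δ hδ => ?_⟩
  have hn : (0 : ℝ) < Fintype.card ι + 1 := by positivity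
  -- Lowering each entry makes the minorants strict at a total cost below `δ`; the `+ 1` covers an
  -- empty index type.
  have := hM (fun i => t i - δ / (Fintype.card ι + 1)) (by
    intro i
    rw [ht i, EReal.coe_lt_coe_iff]
    have : 0 < δ / (Fintype.card ι + 1) := by positivity
    linarith)
  simp only [Finset.sum_sub_distrib, Finset.sum_const, Finset.card_univ, _root_.nsmul_eq_mul] at this
  have h2 : (Fintype.card ι : ℝ) * (δ / (Fintype.card ι + 1)) ≤ δ := by
    rw [mul_div_assoc', div_le_iff₀ hn]; nlinarith
  linarith

end ExtendedReal

/-- An affine function of `t` that is nonnegative on `(0, 1]` is nonnegative at `0`. -/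
lemma nonneg_of_forall_add_mul_nonneg {A B : ℝ}
    (h : ∀ t : ℝ, 0 < t → t ≤ 1 → 0 ≤ A + t * B) : 0 ≤ A := by
  by_contra! hA
  have hd : 0 < |B| + |A| + 1 := by positivity
  -- This `t` lies in `(0, 1]` and is small enough that `t * |B| < -A`.
  have h1 := h (-A / (|B| + |A| + 1)) (div_pos (by linarith) hd)
    ((div_le_one hd).2 (by rw [abs_of_neg hA]; linarith [abs_nonneg B]))
  have h2 : -A / (|B| + |A| + 1) * B < -A := by
    rw [div_mul_eq_mul_div, div_lt_iff₀ hd]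
    nlinarith [le_abs_self B, abs_nonneg B, abs_nonneg A]
  linarith

lemma IsProx.ne_top {E : Type*} [NormedAddCommGroup E] {F : E → EReal} {c : ℝ}
    (hc : 0 < c) (hF : ∃ x, F x ≠ ⊤) (hbot : ∀ x, F x ≠ ⊥) {u x : E} (hx : IsProx c F u x) : F x ≠ ⊤ := by
  obtain ⟨z, hz⟩ := hF
  obtain ⟨b, hb⟩ := EReal.exists_coe_eq (hbot z) hz
  intro h
  have := hx z
  rw [h, hb, EReal.coe_mul_top_of_pos hc, EReal.add_top_of_ne_bot (EReal.coe_ne_bot _),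
    ← EReal.coe_mul, ← EReal.coe_add, top_le_iff] at this
  exact EReal.coe_ne_top _ this

/-! ### Proximal points, conjugates and Fenchel-Moreau duality. -/

section Convex

variable {E : Type*} [NormedAddCommGroup E] [InnerProductSpace ℝ E] {F : E → EReal}

lemma epigraph_segment (hconv : Convex ℝ {p : E × ℝ | F p.1 ≤ (p.2 : EReal)}) {x z : E} {a b t : ℝ}
    (ha : F x ≤ a) (hb : F z ≤ b) (ht0 : 0 ≤ t) (ht1 : t ≤ 1) :
    F (x + t • (z - x)) ≤ ((a + t * (b - a) : ℝ) : EReal) := by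
  have := hconv (x := (x, a)) ha (y := (z, b)) hb (a := 1 - t) (b := t) (by linarith) ht0 (by ring)
  simp only [Set.mem_ofPred_eq, Prod.fst_add, Prod.smul_fst, Prod.snd_add, Prod.smul_snd,
    smul_eq_mul] at this
  convert this using 2
  · module
  · ring

/-- The variational inequality of the proximal point: `(u - x) / c ∈ ∂F(x)`. -/
lemma IsProx.add_inner_le {c : ℝ} (hc : 0 < c)
    (hconv : Convex ℝ {p : E × ℝ | F p.1 ≤ (p.2 : EReal)}) {u x : E}
    (hx : IsProx c F u x) {a : ℝ} (ha : F x = a) {z : E} {b : ℝ} (hb : F z ≤ b) :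
    c * a + ⟪u - x, z - x⟫ ≤ c * b := by
  have key : 0 ≤ ⟪x - u, z - x⟫ + c * (b - a) := by
    -- Minimality of `x` is tested at `x + t • (z - x)`; dividing by `t` leaves a remainder linear
    -- in `t`.
    refine nonneg_of_forall_add_mul_nonneg (B := ‖z - x‖ ^ 2 / 2) fun t ht0 ht1 => ?_
    have h1 := epigraph_segment hconv ha.le hb ht0.le ht1
    have h2 := (hx (x + t • (z - x))).trans
      (add_le_add_right (mul_le_mul_of_nonneg_left h1 (EReal.coe_nonneg.2 hc.le)) _)
    rw [ha, ← EReal.coe_mul, ← EReal.coe_mul, ← EReal.coe_add, ← EReal.coe_add,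
      EReal.coe_le_coe_iff, show x + t • (z - x) - u = (x - u) + t • (z - x) by abel,
      norm_add_sq_real, inner_smul_right, norm_smul, mul_pow, Real.norm_eq_abs, sq_abs] at h2
    have h3 : 0 ≤ t * (⟪x - u, z - x⟫ + c * (b - a) + t * (‖z - x‖ ^ 2 / 2)) := by
      nlinarith
    exact nonneg_of_mul_nonneg_right h3 ht0
  have : ⟪x - u, z - x⟫ = -⟪u - x, z - x⟫ := by rw [← inner_neg_left, neg_sub]
  linarith

/-- A point satisfying the variational inequality is the proximal point. -/
lemma isProx_of_add_inner_le {c : ℝ} (hc : 0 < c) (hbot : ∀ x, F x ≠ ⊥) {u x : E} {a : ℝ}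
    (ha : F x = a) (h : ∀ z (b : ℝ), F z = b → c * a + ⟪u - x, z - x⟫ ≤ c * b) :
    IsProx c F u x := by
  intro z
  rcases eq_or_ne (F z) ⊤ with hz | hz
  · rw [hz, EReal.coe_mul_top_of_pos hc, EReal.add_top_of_ne_bot (EReal.coe_ne_bot _)]
    exact le_top
  obtain ⟨b, hb⟩ := EReal.exists_coe_eq (hbot z) hz
  have h1 := h z b hb
  rw [ha, hb, ← EReal.coe_mul, ← EReal.coe_mul, ← EReal.coe_add, ← EReal.coe_add,
      EReal.coe_le_coe_iff, show z - u = (z - x) - (u - x) by abel, norm_sub_sq_real (z - x),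
      norm_sub_rev x u, real_inner_comm]
  nlinarith [sq_nonneg ‖z - x‖]

/-- The proximal map is firmly nonexpansive. -/
lemma IsProx.norm_sub_sq_le_inner {c : ℝ} (hc : 0 < c) (hF : IsGammaZero F) {u u' x x' : E}
    (hx : IsProx c F u x) (hx' : IsProx c F u' x') : ‖x - x'‖ ^ 2 ≤ ⟪u - u', x - x'⟫ := by
  obtain ⟨a, ha⟩ := EReal.exists_coe_eq (hF.ne_bot x) (hx.ne_top hc hF.exists_ne_top hF.ne_bot)
  obtain ⟨a', ha'⟩ := EReal.exists_coe_eq (hF.ne_bot x') (hx'.ne_top hc hF.exists_ne_top hF.ne_bot)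
  have h1 := hx.add_inner_le hc hF.convex ha ha'.le
  have h2 := hx'.add_inner_le hc hF.convex ha' ha.le
  have h3 : ⟪u - x, x' - x⟫ = -⟪u - x, x - x'⟫ := by rw [← inner_neg_right, neg_sub]
  have h4 : ⟪u - u', x - x'⟫ - ‖x - x'‖ ^ 2 = ⟪u - x, x - x'⟫ - ⟪u' - x', x - x'⟫ := by
    rw [← real_inner_self_eq_norm_sq, ← inner_sub_left, ← inner_sub_left]
    congr 1; abel
  linarith

lemma fenchelConj_le_iff (hbot : ∀ x, F x ≠ ⊥) {y : E} {b : ℝ} :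
    fenchelConj F y ≤ b ↔ ∀ x (r : ℝ), F x = r → ⟪x, y⟫ - r ≤ b := by
  rw [fenchelConj, iSup_le_iff]
  refine forall_congr' fun x => ?_
  rcases eq_or_ne (F x) ⊤ with hx | hx
  · simp [hx]
  obtain ⟨r, hr⟩ := EReal.exists_coe_eq (hbot x) hx
  rw [hr, ← EReal.coe_sub, EReal.coe_le_coe_iff]
  refine ⟨fun h s hs => ?_, fun h => h r rfl⟩
  rwa [← EReal.coe_injective hs]

/-- The Fenchel-Young inequality. -/
lemma inner_le_of_fenchelConj_le (hbot : ∀ x, F x ≠ ⊥) {x y : E} {a b : ℝ} (ha : F x = a)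
    (hb : fenchelConj F y ≤ b) : ⟪x, y⟫ ≤ a + b := by
  linarith [(fenchelConj_le_iff hbot).1 hb x a ha]

lemma IsGammaZero.fenchelConj_ne_bot (hF : IsGammaZero F) (y : E) : fenchelConj F y ≠ ⊥ := by
  obtain ⟨x, hx⟩ := hF.exists_ne_top
  obtain ⟨r, hr⟩ := EReal.exists_coe_eq (hF.ne_bot x) hx
  intro h
  have h1 := inner_le_of_fenchelConj_le (y := y) (b := ⟪x, y⟫ - r - 1) hF.ne_bot hr
    (by rw [h]; exact bot_le)
  linarith

lemma IsGammaZero.isClosed_epigraph (hF : IsGammaZero F) :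
    IsClosed {p : E × ℝ | F p.1 ≤ (p.2 : EReal)} :=
  hF.lsc.isClosed_epigraph.preimage
    (continuous_fst.prodMk (continuous_coe_real_ereal.comp continuous_snd))

/-- Separation of a point below the graph from the epigraph. -/
lemma IsGammaZero.exists_separating [CompleteSpace E] (hF : IsGammaZero F) {v : E} {a : ℝ}
    (ha : (a : EReal) < F v) :
    ∃ (y : E) (s c : ℝ), 0 ≤ s ∧ ⟪v, y⟫ + s * a < c ∧
      ∀ x (b : ℝ), F x = b → c < ⟪x, y⟫ + s * b := by
  obtain ⟨φ, c, h1, h2⟩ := geometric_hahn_banach_point_closed (x := ((v, a) : E × ℝ))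
    hF.convex hF.isClosed_epigraph (by simpa using ha)
  -- Riesz representative of the horizontal part of `φ`; the vertical part is the number `φ (0, 1)`.
  set y := (InnerProductSpace.toDual ℝ E).symm (φ.comp (ContinuousLinearMap.inl ℝ E ℝ))
  have hφ : ∀ x b, φ (x, b) = ⟪x, y⟫ + φ (0, 1) * b := by
    intro x b
    have : ((x, b) : E × ℝ) = (x, 0) + b • (0, 1) := by simp
    rw [this, map_add, map_smul, real_inner_comm, InnerProductSpace.toDual_symm_apply, smul_eq_mul,
      mul_comm b]
    rfl
  refine ⟨y, φ (0, 1), c, ?_, by rw [← hφ]; exact h1, fun x b hb => by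
    rw [← hφ]; exact h2 (x, b) (by simp [hb])⟩
  obtain ⟨x, hx⟩ := hF.exists_ne_top
  obtain ⟨r, hr⟩ := EReal.exists_coe_eq (hF.ne_bot x) hx
  -- With a negative vertical slope, moving up the epigraph would bring the functional down to `c`;
  -- the height in `h5` reaches `c` exactly.
  by_contra! hs
  have h3 : ∀ n : ℝ, 0 ≤ n → c < ⟪x, y⟫ + φ (0, 1) * (r + n) := by
    intro n hn
    rw [← hφ]
    refine h2 (x, r + n) ?_
    simp only [Set.mem_ofPred_eq, hr, EReal.coe_le_coe_iff]
    linarith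
  have h4 := h3 0 le_rfl
  have h5 := h3 ((⟪x, y⟫ + φ (0, 1) * r - c) / (-φ (0, 1)))
    (div_nonneg (by linarith) (by linarith))
  have h6 : φ (0, 1) * ((⟪x, y⟫ + φ (0, 1) * r - c) / (-φ (0, 1)))
      = -(⟪x, y⟫ + φ (0, 1) * r - c) := by
    rw [div_neg, mul_neg, mul_div_cancel₀ _ hs.ne]
  rw [mul_add, h6] at h5
  linarith

/-- A non-vertical hyperplane, divided by its vertical coefficient `s`, is the graph of an affine
minorant. -/
lemma IsGammaZero.exists_fenchelConj_le_of_separating (hF : IsGammaZero F) {v y : E} {a s c : ℝ}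
    (hs : 0 < s) (h1 : ⟪v, y⟫ + s * a < c) (h2 : ∀ x (b : ℝ), F x = b → c < ⟪x, y⟫ + s * b) :
    ∃ (q : E) (b : ℝ), fenchelConj F q ≤ b ∧ a < ⟪v, q⟫ - b := by
  refine ⟨-(s⁻¹ • y), -(s⁻¹ * c), (fenchelConj_le_iff hF.ne_bot).2 fun x r hr => ?_, ?_⟩
  · have := mul_lt_mul_of_pos_left (h2 x r hr) (inv_pos.2 hs)
    rw [mul_add, inv_mul_cancel_left₀ hs.ne'] at this
    rw [inner_neg_right, inner_smul_right]
    linarith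
  · have := mul_lt_mul_of_pos_left h1 (inv_pos.2 hs)
    rw [mul_add, inv_mul_cancel_left₀ hs.ne'] at this
    rw [inner_neg_right, inner_smul_right]
    linarith

/-- The Fenchel-Moreau theorem: every real number below `F v` is exceeded by an affine minorant. -/
lemma IsGammaZero.exists_lt_inner_sub [CompleteSpace E] (hF : IsGammaZero F) {v : E} {a : ℝ}
    (ha : (a : EReal) < F v) :
    ∃ (q : E) (b : ℝ), fenchelConj F q ≤ b ∧ a < ⟪v, q⟫ - b := by
  obtain ⟨y, s, c, hs, h1, h2⟩ := hF.exists_separating ha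
  rcases hs.lt_or_eq with hs | rfl
  · exact hF.exists_fenchelConj_le_of_separating hs h1 h2
  -- The hyperplane is vertical. A minorant built at a point of finite value is tilted by a large
  -- multiple of `c - ⟪·, y⟫`, which is negative on the domain of `F` and positive at `v`.
  obtain ⟨x, hx⟩ := hF.exists_ne_top
  obtain ⟨r, hr⟩ := EReal.exists_coe_eq (hF.ne_bot x) hx
  obtain ⟨y', s', c', hs', h1', h2'⟩ := hF.exists_separating (v := x) (a := r - 1)
    (by rw [hr, EReal.coe_lt_coe_iff]; linarith)
  have hs'' : 0 < s' := by
    have := h2' x r hr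
    nlinarith
  obtain ⟨q, b, hq, -⟩ := hF.exists_fenchelConj_le_of_separating hs'' h1' h2'
  simp only [zero_mul, add_zero] at h1 h2
  have hd : 0 < c - ⟪v, y⟫ := by linarith
  set t := (|a - ⟪v, q⟫ + b| + 1) / (c - ⟪v, y⟫) with ht
  have ht0 : 0 < t := by positivity
  have htd : t * (c - ⟪v, y⟫) = |a - ⟪v, q⟫ + b| + 1 := by rw [ht]; field_simp
  refine ⟨q - t • y, b - t * c, (fenchelConj_le_iff hF.ne_bot).2 fun z ρ hρ => ?_, ?_⟩
  · have h3 := inner_le_of_fenchelConj_le hF.ne_bot hρ hq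
    have h4 := mul_lt_mul_of_pos_left (h2 z ρ hρ) ht0
    rw [inner_sub_right, inner_smul_right]
    linarith
  · rw [inner_sub_right, inner_smul_right]
    linarith [le_abs_self (a - ⟪v, q⟫ + b)]

/-- The Fenchel conjugate of a function in `Γ₀(E)` is in `Γ₀(E)`. -/
lemma IsGammaZero.fenchelConj [CompleteSpace E] (hF : IsGammaZero F) :
    IsGammaZero (fenchelConj F) where
  ne_bot := hF.fenchelConj_ne_bot
  exists_ne_top := by
    obtain ⟨x, -⟩ := hF.exists_ne_top
    obtain ⟨a, ha⟩ := EReal.exists_coe_lt (hF.ne_bot x)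
    obtain ⟨q, b, hq, -⟩ := hF.exists_lt_inner_sub ha
    exact ⟨q, (hq.trans_lt (EReal.coe_lt_top b)).ne⟩
  lsc := by
    refine lowerSemicontinuous_iSup fun x => ?_
    rcases eq_or_ne (F x) ⊤ with hx | hx
    · simpa [hx] using lowerSemicontinuous_const
    obtain ⟨r, hr⟩ := EReal.exists_coe_eq (hF.ne_bot x) hx
    simp only [hr, ← EReal.coe_sub]
    exact (continuous_coe_real_ereal.comp (by fun_prop)).lowerSemicontinuous
  convex := by
    rintro ⟨y, b⟩ hy ⟨y', b'⟩ hy' s t hs ht hst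
    simp only [Set.mem_ofPred_eq, Prod.fst_add, Prod.smul_fst, Prod.snd_add, Prod.smul_snd,
      smul_eq_mul] at hy hy' ⊢
    rw [fenchelConj_le_iff hF.ne_bot] at hy hy' ⊢
    intro x r hr
    rw [inner_add_right, inner_smul_right, inner_smul_right]
    have h1 := mul_le_mul_of_nonneg_left (hy x r hr) hs
    have h2 := mul_le_mul_of_nonneg_left (hy' x r hr) ht
    have h3 : r = s * r + t * r := by rw [← add_mul, hst, one_mul]
    linarith

lemma lowerSemicontinuous_add_of_ne_bot {X : Type*} [TopologicalSpace X] {φ ψ : X → EReal}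
    (hφ : LowerSemicontinuous φ) (hψ : LowerSemicontinuous ψ) (h1 : ∀ x, φ x ≠ ⊥)
    (h2 : ∀ x, ψ x ≠ ⊥) : LowerSemicontinuous fun x => φ x + ψ x :=
  hφ.add' hψ fun x => EReal.continuousAt_add (Or.inr (h2 x)) (Or.inl (h1 x))

lemma lowerSemicontinuous_finsetSum_of_ne_bot {X ι : Type*} [TopologicalSpace X]
    {φ : ι → X → EReal} (hφ : ∀ i, LowerSemicontinuous (φ i)) (h : ∀ i x, φ i x ≠ ⊥)
    (s : Finset ι) : LowerSemicontinuous fun x => ∑ i ∈ s, φ i x := by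
  classical
  induction s using Finset.induction_on with
  | empty => simpa using lowerSemicontinuous_const
  | insert i s hi ih =>
    simp only [Finset.sum_insert hi]
    exact lowerSemicontinuous_add_of_ne_bot (hφ i) ih (h i)
      fun x => EReal.finsetSum_ne_bot s fun i => h i x

/-- In finite dimensions proximal points exist. -/
lemma IsGammaZero.exists_isProx [FiniteDimensional ℝ E] (hF : IsGammaZero F) {c : ℝ} (hc : 0 < c)
    (u : E) : ∃ x, IsProx c F u x := by
  have : CompleteSpace E := FiniteDimensional.complete ℝ E
  have : ProperSpace E := FiniteDimensional.proper_real E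
  obtain ⟨x₀, hx₀⟩ := hF.exists_ne_top
  obtain ⟨r, hr⟩ := EReal.exists_coe_eq (hF.ne_bot x₀) hx₀
  obtain ⟨a, ha⟩ := EReal.exists_coe_lt (hF.ne_bot x₀)
  obtain ⟨q, b, hq, -⟩ := hF.exists_lt_inner_sub ha
  set J : E → EReal := fun z => ((‖z - u‖ ^ 2 / 2 : ℝ) : EReal) + (c : EReal) * F z with hJ
  have hlsc : LowerSemicontinuous J := by
    refine lowerSemicontinuous_add_of_ne_bot
      (continuous_coe_real_ereal.comp (by fun_prop)).lowerSemicontinuous ?_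
      (fun x => EReal.coe_ne_bot _) fun x => EReal.coe_mul_ne_bot hc (hF.ne_bot x)
    intro x y hy
    have hcont : ContinuousAt (fun p : EReal => (c : EReal) * p) (F x) :=
      EReal.Tendsto.const_mul tendsto_id
        (Or.inl (by simp)) (Or.inl (by simp))
    exact hcont.comp_lowerSemicontinuousAt (hF.lsc x)
      (fun p p' h => mul_le_mul_of_nonneg_left h (EReal.coe_nonneg.2 hc.le)) y hy
  set C := ‖x₀ - u‖ ^ 2 / 2 + c * r with hC
  -- The ball contains `x₀`, and outside it the quadratic term dominates the affine minorant of `F`,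
  -- so the objective is at least its value `C` at `x₀`.
  set R := 2 * c * ‖q‖ + 2 * |C - c * (⟪u, q⟫ - b)| + 1 + ‖x₀ - u‖ with hR
  obtain ⟨x, hxR, hx⟩ := (hlsc.lowerSemicontinuousOn _).exists_isMinOn
    (s := Metric.closedBall u R)
    ⟨x₀, by rw [Metric.mem_closedBall, dist_eq_norm]; rw [hR];
            linarith [mul_nonneg hc.le (norm_nonneg q), abs_nonneg (C - c * (⟪u, q⟫ - b))]⟩
    (isCompact_closedBall u R)
  have hx₀R : x₀ ∈ Metric.closedBall u R := by
    rw [Metric.mem_closedBall, dist_eq_norm, hR]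
    linarith [mul_nonneg hc.le (norm_nonneg q), abs_nonneg (C - c * (⟪u, q⟫ - b))]
  have hxC : J x ≤ (C : EReal) := by
    have h1 : J x ≤ J x₀ := hx hx₀R
    refine h1.trans ?_
    simp only [hJ, hr, ← EReal.coe_mul, ← EReal.coe_add, hC, le_refl]
  refine ⟨x, fun z => ?_⟩
  by_cases hz : z ∈ Metric.closedBall u R
  · exact hx hz
  refine hxC.trans ?_
  rcases eq_or_ne (F z) ⊤ with hz' | hz'
  · rw [hz', EReal.coe_mul_top_of_pos hc, EReal.add_top_of_ne_bot (EReal.coe_ne_bot _)]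
    exact le_top
  obtain ⟨ρ, hρ⟩ := EReal.exists_coe_eq (hF.ne_bot z) hz'
  rw [hρ, ← EReal.coe_mul, ← EReal.coe_add, EReal.coe_le_coe_iff]
  rw [Metric.mem_closedBall, dist_eq_norm, not_le] at hz
  have h1 := inner_le_of_fenchelConj_le hF.ne_bot hρ hq
  have h2 : ⟪z, q⟫ = ⟪z - u, q⟫ + ⟪u, q⟫ := by rw [← inner_add_left, sub_add_cancel]
  have h3 : -(‖z - u‖ * ‖q‖) ≤ ⟪z - u, q⟫ := (abs_le.1 (abs_real_inner_le_norm _ _)).1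
  have h4 : c * (-(‖z - u‖ * ‖q‖) + ⟪u, q⟫ - b) ≤ c * ρ := by
    apply mul_le_mul_of_nonneg_left _ hc.le; linarith
  have hN : 1 ≤ ‖z - u‖ := by
    have := mul_nonneg hc.le (norm_nonneg q)
    linarith [abs_nonneg (C - c * (⟪u, q⟫ - b)), norm_nonneg (x₀ - u)]
  have h5 : 2 * |C - c * (⟪u, q⟫ - b)| ≤ ‖z - u‖ - 2 * c * ‖q‖ := by
    linarith [norm_nonneg (x₀ - u)]
  have h6 : ‖z - u‖ - 2 * c * ‖q‖ ≤ ‖z - u‖ * (‖z - u‖ - 2 * c * ‖q‖) := by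
    nlinarith [abs_nonneg (C - c * (⟪u, q⟫ - b))]
  nlinarith [le_abs_self (C - c * (⟪u, q⟫ - b))]

end Convex

/-! ### Convex functions with Lipschitz gradient. -/

section SmoothConvex

variable {H : Type*} [NormedAddCommGroup H] [InnerProductSpace ℝ H] [CompleteSpace H]
  {f : H → ℝ} {L : ℝ}

lemma hasDerivAt_comp_line (hf : Differentiable ℝ f) (x d : H) (t : ℝ) :
    HasDerivAt (fun s : ℝ => f (x + s • d)) ⟪∇ f (x + t • d), d⟫ t := by
  have h1 := (hf (x + t • d)).hasGradientAt.hasFDerivAt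
  have h2 : HasDerivAt (fun s : ℝ => x + s • d) d t := by
    simpa using ((hasDerivAt_id t).smul_const d).const_add x
  have h3 := h1.comp_hasDerivAt t h2
  rwa [InnerProductSpace.toDual_apply_apply] at h3

/-- The gradient of a convex function is a subgradient. -/
lemma ConvexOn.add_inner_gradient_le (hc : ConvexOn ℝ Set.univ f) (hf : Differentiable ℝ f)
    (x y : H) : f x + ⟪∇ f x, y - x⟫ ≤ f y := by
  have hconv : ConvexOn ℝ Set.univ fun s : ℝ => f (x + s • (y - x)) := by
    refine ⟨convex_univ, fun s _ t _ a b ha hb hab => ?_⟩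
    have := hc.2 (Set.mem_univ (x + s • (y - x))) (Set.mem_univ (x + t • (y - x))) ha hb hab
    convert this using 2
    have h1 : b = 1 - a := by linarith
    subst h1
    simp only [smul_eq_mul]
    module
  have h1 := hconv.deriv_le_slope (Set.mem_univ 0) (Set.mem_univ 1) zero_lt_one
    (hasDerivAt_comp_line hf x (y - x) 0).differentiableAt
  rw [(hasDerivAt_comp_line hf x (y - x) 0).deriv] at h1
  simp only [slope_def_field, zero_smul, one_smul, add_zero, add_sub_cancel, sub_zero, div_one]
    at h1
  linarith

/-- The descent lemma. -/
lemma le_add_inner_gradient_add_sq (hf : Differentiable ℝ f)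
    (hL : ∀ a b, ‖∇ f a - ∇ f b‖ ≤ L * ‖a - b‖) (x y : H) :
    f y ≤ f x + ⟪∇ f x, y - x⟫ + L / 2 * ‖y - x‖ ^ 2 := by
  set d := y - x with hd
  set ψ : ℝ → ℝ := fun t => f (x + t • d) - t * ⟪∇ f x, d⟫ - L / 2 * ‖d‖ ^ 2 * t ^ 2 with hψ
  have hder : ∀ t, HasDerivAt ψ
      (⟪∇ f (x + t • d), d⟫ - ⟪∇ f x, d⟫ - L * ‖d‖ ^ 2 * t) t := by
    intro t
    have h := ((hasDerivAt_comp_line hf x d t).sub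
      ((hasDerivAt_id t).mul_const ⟪∇ f x, d⟫)).sub
      (((hasDerivAt_id t).pow 2).const_mul (L / 2 * ‖d‖ ^ 2))
    refine h.congr_deriv ?_
    simp only [one_mul, id, pow_one, Nat.cast_ofNat, Nat.add_one_sub_one]
    ring
  have hanti : AntitoneOn ψ (Set.Icc 0 1) := by
    refine antitoneOn_of_deriv_nonpos (convex_Icc 0 1)
      (fun t _ => (hder t).continuousAt.continuousWithinAt)
      (fun t _ => (hder t).differentiableAt.differentiableWithinAt) fun t ht => ?_
    rw [interior_Icc] at ht
    rw [(hder t).deriv, ← inner_sub_left]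
    have h1 := real_inner_le_norm (∇ f (x + t • d) - ∇ f x) d
    have h2 := hL (x + t • d) x
    rw [add_sub_cancel_left, norm_smul, Real.norm_eq_abs, abs_of_pos ht.1] at h2
    have h3 := mul_le_mul_of_nonneg_right h2 (norm_nonneg d)
    nlinarith
  have := hanti (Set.left_mem_Icc.2 zero_le_one) (Set.right_mem_Icc.2 zero_le_one) zero_le_one
  simp only [hψ, one_smul, zero_smul, add_zero, zero_mul, one_mul, one_pow, mul_one, sub_zero,
    mul_zero, ne_eq, OfNat.ofNat_ne_zero, not_false_eq_true, zero_pow] at this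
  rw [hd, add_sub_cancel, ← hd] at this
  linarith

/-- The gradient of a convex function with `L`-Lipschitz gradient is `1/L`-cocoercive
(Baillon-Haddad). -/
lemma ConvexOn.norm_gradient_sub_sq_le (hc : ConvexOn ℝ Set.univ f) (hf : Differentiable ℝ f)
    (hL0 : 0 < L) (hL : ∀ a b, ‖∇ f a - ∇ f b‖ ≤ L * ‖a - b‖) (x y : H) :
    ‖∇ f x - ∇ f y‖ ^ 2 ≤ L * ⟪∇ f x - ∇ f y, x - y⟫ := by
  -- The test point `y - L⁻¹ • e` minimizes the descent bound at `y` minus the affine minorant at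
  -- `x`. Adding the inequality to its version with `x` and `y` swapped gives cocoercivity.
  have key : ∀ x y : H, f x + ⟪∇ f x, y - x⟫ + 1 / (2 * L) * ‖∇ f y - ∇ f x‖ ^ 2 ≤ f y := by
    intro x y
    set e := ∇ f y - ∇ f x with he
    have h1 := hc.add_inner_gradient_le hf x (y - L⁻¹ • e)
    have h2 := le_add_inner_gradient_add_sq hf hL y (y - L⁻¹ • e)
    rw [sub_sub_cancel_left, norm_neg, norm_smul, inner_neg_right, inner_smul_right, mul_pow,
      Real.norm_eq_abs, sq_abs] at h2
    rw [sub_right_comm, inner_sub_right, inner_smul_right] at h1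
    have h3 : ⟪∇ f y, e⟫ - ⟪∇ f x, e⟫ = ‖e‖ ^ 2 := by
      rw [← inner_sub_left, ← he, real_inner_self_eq_norm_sq]
    have h4 : ⟪∇ f y, e⟫ = ⟪∇ f x, e⟫ + ‖e‖ ^ 2 := by linarith
    rw [h4] at h2
    have h5 : L / 2 * (L⁻¹ ^ 2 * ‖e‖ ^ 2) = 1 / (2 * L) * ‖e‖ ^ 2 := by field_simp
    have h6 : L⁻¹ * ‖e‖ ^ 2 = 2 * (1 / (2 * L) * ‖e‖ ^ 2) := by field_simp
    rw [h5] at h2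
    linarith
  have h1 := key x y
  have h2 := key y x
  have h3 : ⟪∇ f x, y - x⟫ = -⟪∇ f x, x - y⟫ := by rw [← inner_neg_right, neg_sub]
  rw [norm_sub_rev] at h1
  rw [inner_sub_left]
  have h4 : 2 * (1 / (2 * L) * ‖∇ f x - ∇ f y‖ ^ 2) = ‖∇ f x - ∇ f y‖ ^ 2 / L := by field_simp
  have h5 : ‖∇ f x - ∇ f y‖ ^ 2 / L ≤ ⟪∇ f x, x - y⟫ - ⟪∇ f y, x - y⟫ := by linarith
  rw [div_le_iff₀ hL0] at h5
  linarith

end SmoothConvex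

/-- A nonnegative sequence that increases by summable amounts converges. -/
lemma exists_tendsto_of_le_add_summable {a e : ℕ → ℝ} (ha : ∀ k, 0 ≤ a k) (he : ∀ k, 0 ≤ e k)
    (hs : Summable e) (h : ∀ k, a (k + 1) ≤ a k + e k) : ∃ l, Tendsto a atTop (𝓝 l) := by
  set b : ℕ → ℝ := fun k => a k - ∑ i ∈ Finset.range k, e i with hb
  have hanti : Antitone b := antitone_nat_of_succ_le fun k => by
    simp only [hb, Finset.sum_range_succ]
    linarith [h k]
  have hbdd : BddBelow (Set.range b) := ⟨-∑' i, e i, by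
    rintro _ ⟨k, rfl⟩
    have := hs.sum_le_tsum (Finset.range k) fun i _ => he i
    simp only [hb]
    linarith [ha k]⟩
  have h1 := (tendsto_atTop_ciInf hanti hbdd).add hs.hasSum.tendsto_sum_nat
  exact ⟨_, h1.congr fun k => by simp [hb]⟩

/-! ### The inexact forward-backward method. -/

section ForwardBackward

variable {H : Type*} [NormedAddCommGroup H] [InnerProductSpace ℝ H] [CompleteSpace H]
  {f : H → ℝ} {L γ : ℝ} {Φ : H → EReal}

/-- Minimizers of `f + Φ` are the fixed points of the forward-backward operator. -/
lemma isProx_gradient_step_iff (hc : ConvexOn ℝ Set.univ f) (hf : Differentiable ℝ f)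
    (hΦ : IsGammaZero Φ) (hγ : 0 < γ) {z : H} :
    IsProx γ Φ (z - γ • ∇ f z) z ↔
      Φ z ≠ ⊤ ∧ ∀ x, (f z : EReal) + Φ z ≤ (f x : EReal) + Φ x := by
  constructor
  · intro hz
    have htop := hz.ne_top hγ hΦ.exists_ne_top hΦ.ne_bot
    refine ⟨htop, fun x => ?_⟩
    obtain ⟨a, ha⟩ := EReal.exists_coe_eq (hΦ.ne_bot z) htop
    rcases eq_or_ne (Φ x) ⊤ with hx | hx
    · rw [hx, EReal.add_top_of_ne_bot (EReal.coe_ne_bot _)]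
      exact le_top
    obtain ⟨b, hb⟩ := EReal.exists_coe_eq (hΦ.ne_bot x) hx
    have h1 := hz.add_inner_le hγ hΦ.convex ha hb.le
    rw [sub_sub_cancel_left, inner_neg_left, real_inner_smul_left] at h1
    have h2 := hc.add_inner_gradient_le hf z x
    rw [ha, hb, ← EReal.coe_add, ← EReal.coe_add, EReal.coe_le_coe_iff]
    have h3 : γ * (a - ⟪∇ f z, x - z⟫) ≤ γ * b := by linarith
    linarith [le_of_mul_le_mul_left h3 hγ]
  · rintro ⟨htop, hz⟩
    obtain ⟨a, ha⟩ := EReal.exists_coe_eq (hΦ.ne_bot z) htop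
    refine isProx_of_add_inner_le hγ hΦ.ne_bot ha fun x b hb => ?_
    rw [sub_sub_cancel_left, inner_neg_left, real_inner_smul_left]
    have hder := hasDerivAt_comp_line hf z (x - z) 0
    rw [zero_smul, add_zero] at hder
    -- Only `f` is differentiable: along the segment convexity bounds the increase of `Φ`, and the
    -- right derivative of `f` at `0` gives the limit.
    have key : -⟪∇ f z, x - z⟫ ≤ b - a := by
      have hslope := hder.tendsto_slope_zero_right
      refine le_of_tendsto hslope.neg ?_
      filter_upwards [Ioo_mem_nhdsGT (zero_lt_one' ℝ)] with t ht
      have h1 := (hz (z + t • (x - z))).trans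
        (add_le_add_right (epigraph_segment hΦ.convex ha.le hb.le ht.1.le ht.2.le) _)
      rw [ha, ← EReal.coe_add, ← EReal.coe_add, EReal.coe_le_coe_iff] at h1
      simp only [zero_add, zero_smul, add_zero, smul_eq_mul]
      rw [← mul_neg, inv_mul_le_iff₀ ht.1]
      linarith
    nlinarith

/-- Firm nonexpansiveness of the proximal map combined with cocoercivity of the gradient. Both
surplus terms are kept, since together they force `x k - T (x k)` to vanish. -/
lemma IsProx.norm_sub_sq_add_le (hc : ConvexOn ℝ Set.univ f) (hf : Differentiable ℝ f)
    (hL0 : 0 < L) (hL : ∀ a b, ‖∇ f a - ∇ f b‖ ≤ L * ‖a - b‖) (hΦ : IsGammaZero Φ)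
    (hγ : 0 < γ) {x x' p p' : H}
    (hp : IsProx γ Φ (x - γ • ∇ f x) p) (hp' : IsProx γ Φ (x' - γ • ∇ f x') p') :
    ‖p - p'‖ ^ 2 + γ * (2 / L - γ) * ‖∇ f x - ∇ f x'‖ ^ 2
      + ‖(x - γ • ∇ f x - p) - (x' - γ • ∇ f x' - p')‖ ^ 2 ≤ ‖x - x'‖ ^ 2 := by
  have h1 := hp.norm_sub_sq_le_inner hγ hΦ hp'
  have h2 := hc.norm_gradient_sub_sq_le hf hL0 hL x x'
  set e := ∇ f x - ∇ f x' with he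
  set d := x - x' with hd
  have h3 : x - γ • ∇ f x - (x' - γ • ∇ f x') = d - γ • e := by rw [hd, he]; module
  have h4 : (x - γ • ∇ f x - p) - (x' - γ • ∇ f x' - p') = (d - γ • e) - (p - p') := by
    rw [hd, he]; module
  rw [h3] at h1
  rw [h4, norm_sub_sq_real (d - γ • e), norm_sub_sq_real d, norm_smul, inner_smul_right, mul_pow,
    Real.norm_eq_abs, sq_abs]
  have h5 : ‖e‖ ^ 2 / L ≤ ⟪d, e⟫ := by
    rw [div_le_iff₀ hL0, real_inner_comm]; linarith
  have h6 : γ * (2 / L - γ) * ‖e‖ ^ 2 = 2 * γ * (‖e‖ ^ 2 / L) - γ ^ 2 * ‖e‖ ^ 2 := by ring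
  have h7 := mul_le_mul_of_nonneg_left h5 (mul_nonneg zero_le_two hγ.le)
  linarith

/-- The forward-backward method with summable errors converges in finite dimensions. -/
theorem exists_tendsto_of_inexact_forwardBackward [FiniteDimensional ℝ H]
    (hc : ConvexOn ℝ Set.univ f) (hf : Differentiable ℝ f)
    (hL0 : 0 < L) (hL : ∀ a b, ‖∇ f a - ∇ f b‖ ≤ L * ‖a - b‖) (hΦ : IsGammaZero Φ)
    (hγ : 0 < γ) (hγL : γ < 2 / L) {z₀ : H} (hz₀ : IsProx γ Φ (z₀ - γ • ∇ f z₀) z₀)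
    {x : ℕ → H} {e : ℕ → ℝ} (he : ∀ k, 0 ≤ e k) (hs : Summable e)
    (hx : ∀ k p, IsProx γ Φ (x k - γ • ∇ f (x k)) p → ‖x (k + 1) - p‖ ≤ e k) :
    ∃ z, IsProx γ Φ (z - γ • ∇ f z) z ∧ Tendsto x atTop (𝓝 z) := by
  have : ProperSpace H := FiniteDimensional.proper_real H
  choose T hT using fun v => hΦ.exists_isProx hγ (v - γ • ∇ f v)
  have hTx : ∀ k, ‖x (k + 1) - T (x k)‖ ≤ e k := fun k => hx k _ (hT _)
  have hdec := fun v (z : H) (hz : IsProx γ Φ (z - γ • ∇ f z) z) =>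
    (hT v).norm_sub_sq_add_le hc hf hL0 hL hΦ hγ hz
  have hcoef : 0 < γ * (2 / L - γ) := mul_pos hγ (by linarith)
  have hne : ∀ v (z : H), IsProx γ Φ (z - γ • ∇ f z) z → ‖T v - z‖ ≤ ‖v - z‖ := by
    intro v z hz
    refine le_of_sq_le_sq ?_ (norm_nonneg _)
    have h1 := hdec v z hz
    have h2 := mul_nonneg hcoef.le (sq_nonneg ‖∇ f v - ∇ f z‖)
    linarith [sq_nonneg ‖(v - γ • ∇ f v - T v) - (z - γ • ∇ f z - z)‖]
  have hstep : ∀ z : H, IsProx γ Φ (z - γ • ∇ f z) z →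
      ∃ l, Tendsto (fun k => ‖x k - z‖) atTop (𝓝 l) := by
    intro z hz
    refine exists_tendsto_of_le_add_summable (fun k => norm_nonneg _) he hs fun k => ?_
    have := norm_sub_le_norm_sub_add_norm_sub (x (k + 1)) (T (x k)) z
    linarith [hTx k, hne (x k) z hz]
  obtain ⟨l, hl⟩ := hstep z₀ hz₀
  have he0 := hs.tendsto_atTop_zero
  -- These distances lie between `‖x (k + 1) - z₀‖ - e k` and `‖x k - z₀‖`.
  have hTl : Tendsto (fun k => ‖T (x k) - z₀‖) atTop (𝓝 l) := by
    have hl1 := (hl.comp (tendsto_add_atTop_nat 1)).sub he0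
    rw [sub_zero] at hl1
    refine tendsto_of_tendsto_of_tendsto_of_le_of_le hl1 hl (fun k => ?_) fun k => hne _ _ hz₀
    have := norm_sub_le_norm_sub_add_norm_sub (x (k + 1)) (T (x k)) z₀
    simp only [Function.comp]
    linarith [hTx k]
  have hdiff : Tendsto (fun k => ‖x k - z₀‖ ^ 2 - ‖T (x k) - z₀‖ ^ 2) atTop (𝓝 0) := by
    simpa using (hl.pow 2).sub (hTl.pow 2)
  have hgrad : Tendsto (fun k => ∇ f (x k) - ∇ f z₀) atTop (𝓝 0) := by
    rw [tendsto_zero_iff_norm_tendsto_zero]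
    have h1 : Tendsto (fun k => ‖∇ f (x k) - ∇ f z₀‖ ^ 2) atTop (𝓝 0) := by
      have h2 := hdiff.const_mul (γ * (2 / L - γ))⁻¹
      rw [mul_zero] at h2
      refine squeeze_zero (fun k => sq_nonneg _) (fun k => ?_) h2
      rw [le_inv_mul_iff₀ hcoef]
      linarith [hdec (x k) z₀ hz₀,
        sq_nonneg ‖(x k - γ • ∇ f (x k) - T (x k)) - (z₀ - γ • ∇ f z₀ - z₀)‖]
    simpa using h1.sqrt
  have hres : Tendsto (fun k => (x k - γ • ∇ f (x k) - T (x k)) - (z₀ - γ • ∇ f z₀ - z₀))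
      atTop (𝓝 0) := by
    rw [tendsto_zero_iff_norm_tendsto_zero]
    have h1 : Tendsto (fun k => ‖(x k - γ • ∇ f (x k) - T (x k)) - (z₀ - γ • ∇ f z₀ - z₀)‖ ^ 2)
        atTop (𝓝 0) := by
      refine squeeze_zero (fun k => sq_nonneg _) (fun k => ?_) hdiff
      linarith [hdec (x k) z₀ hz₀, mul_nonneg hcoef.le (sq_nonneg ‖∇ f (x k) - ∇ f z₀‖)]
    simpa using h1.sqrt
  have hxT : Tendsto (fun k => x k - T (x k)) atTop (𝓝 0) := by
    have h1 := hres.add (hgrad.const_smul γ)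
    simp only [smul_zero, add_zero] at h1
    exact h1.congr fun k => by module
  obtain ⟨R, hR⟩ := hl.bddAbove_range
  obtain ⟨z, -, φ, hφ, hz⟩ := tendsto_subseq_of_bounded
    (Metric.isBounded_closedBall (x := z₀) (r := R)) (x := x) fun k => by
      rw [Metric.mem_closedBall, dist_eq_norm]; exact hR ⟨k, rfl⟩
  have hTz : T z = z := by
    have h1 : Tendsto (fun k => T (x (φ k))) atTop (𝓝 z) := by
      simpa using hz.sub (hxT.comp hφ.tendsto_atTop)
    have h2 : Tendsto (fun k => T (x (φ k))) atTop (𝓝 (T z)) := by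
      rw [tendsto_iff_norm_sub_tendsto_zero] at hz ⊢
      refine squeeze_zero (fun k => norm_nonneg _) (fun k => ?_) hz
      refine le_of_sq_le_sq ?_ (norm_nonneg _)
      have h3 := (hT (x (φ k))).norm_sub_sq_add_le hc hf hL0 hL hΦ hγ (hT z)
      have h4 := mul_nonneg hcoef.le (sq_nonneg ‖∇ f (x (φ k)) - ∇ f z‖)
      simp only [Function.comp]
      linarith [sq_nonneg
        ‖(x (φ k) - γ • ∇ f (x (φ k)) - T (x (φ k))) - (z - γ • ∇ f z - T z)‖]
    exact tendsto_nhds_unique h2 h1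
  have hzfix : IsProx γ Φ (z - γ • ∇ f z) z := by
    have := hT z
    rwa [hTz] at this
  refine ⟨z, hzfix, ?_⟩
  -- The whole sequence of distances to the cluster point converges, and a subsequence tends to
  -- zero.
  obtain ⟨l', hl'⟩ := hstep z hzfix
  have h0 : l' = 0 := tendsto_nhds_unique (hl'.comp hφ.tendsto_atTop)
    (tendsto_iff_norm_sub_tendsto_zero.1 hz)
  rw [tendsto_iff_norm_sub_tendsto_zero]
  exact h0 ▸ hl'

end ForwardBackward

/-! ### The primal-dual metric and the duality gap. -/

section InnerProblem

variable {m : ℕ} {H : Type*} [NormedAddCommGroup H] [InnerProductSpace ℝ H]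
  {G : Fin m → Type*} [∀ i, NormedAddCommGroup (G i)] [∀ i, InnerProductSpace ℝ (G i)]
  {g : H → EReal} {h : ∀ i, G i → EReal} {B : ∀ i, H →L[ℝ] G i} {w : Fin m → ℝ} {γ σ τ : ℝ}

/-- The metric in which the primal-dual iteration is a proximal point iteration. -/
noncomputable def primalDualForm (B : ∀ i, H →L[ℝ] G i) (w : Fin m → ℝ) (σ τ : ℝ)
    (a b : H × ∀ i, G i) : ℝ :=
  τ⁻¹ * ⟪a.1, b.1⟫ +
    ∑ i, w i * (σ⁻¹ * ⟪a.2 i, b.2 i⟫ - ⟪B i a.1, b.2 i⟫ - ⟪B i b.1, a.2 i⟫)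

lemma primalDualForm_comm (a b : H × ∀ i, G i) :
    primalDualForm B w σ τ a b = primalDualForm B w σ τ b a := by
  rw [primalDualForm, primalDualForm, real_inner_comm]
  congr 1
  refine Finset.sum_congr rfl fun i _ => ?_
  rw [real_inner_comm]
  ring

lemma primalDualForm_sub_left (a b c : H × ∀ i, G i) :
    primalDualForm B w σ τ (a - b) c
      = primalDualForm B w σ τ a c - primalDualForm B w σ τ b c := by
  have h1 : ∑ i, w i * (σ⁻¹ * ⟪(a - b).2 i, c.2 i⟫ - ⟪B i (a - b).1, c.2 i⟫
        - ⟪B i c.1, (a - b).2 i⟫)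
      = ∑ i, w i * (σ⁻¹ * ⟪a.2 i, c.2 i⟫ - ⟪B i a.1, c.2 i⟫ - ⟪B i c.1, a.2 i⟫)
        - ∑ i, w i * (σ⁻¹ * ⟪b.2 i, c.2 i⟫ - ⟪B i b.1, c.2 i⟫ - ⟪B i c.1, b.2 i⟫) := by
    rw [← Finset.sum_sub_distrib]
    refine Finset.sum_congr rfl fun i _ => ?_
    rw [Prod.snd_sub, Prod.fst_sub, Pi.sub_apply, map_sub, inner_sub_left, inner_sub_left,
      inner_sub_right]
    ring
  rw [primalDualForm, primalDualForm, primalDualForm, h1, Prod.fst_sub, inner_sub_left]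
  ring

/-- Polarization: it converts the proximal inequality into a decrease of squared distances. -/
lemma two_mul_primalDualForm (a b c : H × ∀ i, G i) :
    2 * primalDualForm B w σ τ (a - b) (c - b) = primalDualForm B w σ τ (a - b) (a - b)
      + primalDualForm B w σ τ (c - b) (c - b) - primalDualForm B w σ τ (a - c) (a - c) := by
  have hr : ∀ x y z, primalDualForm B w σ τ x (y - z)
      = primalDualForm B w σ τ x y - primalDualForm B w σ τ x z := fun x y z => by
    rw [primalDualForm_comm, primalDualForm_sub_left, primalDualForm_comm y, primalDualForm_comm z]
  simp only [primalDualForm_sub_left, hr]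
  rw [primalDualForm_comm c a, primalDualForm_comm b a, primalDualForm_comm c b]
  ring

lemma primalDualForm_sub_swap (a b : H × ∀ i, G i) :
    primalDualForm B w σ τ (a - b) (a - b) = primalDualForm B w σ τ (b - a) (b - a) := by
  have hneg : ∀ x y, primalDualForm B w σ τ (-x) y = -primalDualForm B w σ τ x y := fun x y => by
    have h1 := primalDualForm_sub_left (B := B) (w := w) (σ := σ) (τ := τ) x x (y)
    have h2 := primalDualForm_sub_left (B := B) (w := w) (σ := σ) (τ := τ) (x - x) x y
    rw [sub_self, zero_sub] at h2
    rw [sub_self] at h1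
    linarith
  rw [← neg_sub b a, hneg, primalDualForm_comm, hneg, neg_neg]

lemma continuous_primalDualForm :
    Continuous fun p : (H × ∀ i, G i) × (H × ∀ i, G i) => primalDualForm B w σ τ p.1 p.2 := by
  unfold primalDualForm
  fun_prop

/-- The metric is positive definite when `σ τ ∑ᵢ wᵢ ‖Bᵢ‖² < 1`. -/
lemma exists_le_primalDualForm_self (hw : ∀ i, 0 < w i) (hσ : 0 < σ) (hτ : 0 < τ)
    (hστ : σ * τ * ∑ i, w i * ‖B i‖ ^ 2 < 1) :
    ∃ c > 0, ∀ a : H × ∀ i, G i, c * ‖a‖ ^ 2 ≤ primalDualForm B w σ τ a a := by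
  set β := ∑ i, w i * ‖B i‖ ^ 2 with hβ
  have hβ0 : 0 ≤ β := Finset.sum_nonneg fun i _ => mul_nonneg (hw i).le (sq_nonneg _)
  set ρ := σ * τ * β with hρ
  have hρ0 : 0 ≤ ρ := by positivity
  -- Young parameter for the cross terms: since `ρ < 1`, both `σ < s` and `s * β < τ⁻¹` hold,
  -- leaving positive coefficients in both blocks.
  set s := 2 * σ / (1 + ρ) with hs
  have hs0 : 0 < s := by positivity
  have hc1 : 0 < τ⁻¹ - s * β := by
    have h1 : s * β = 2 * ρ / (1 + ρ) * τ⁻¹ := by rw [hs, hρ]; field_simp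
    have h2 : 2 * ρ / (1 + ρ) < 1 := by rw [div_lt_one (by positivity)]; linarith
    have h3 := mul_lt_mul_of_pos_right h2 (inv_pos.2 hτ)
    rw [h1]; linarith
  have hc2 : 0 < σ⁻¹ - s⁻¹ := by
    have h1 : σ < s := by rw [hs, lt_div_iff₀ (by positivity)]; nlinarith
    linarith [(inv_lt_inv₀ hs0 hσ).2 h1]
  have key : ∀ a : H × ∀ i, G i, (τ⁻¹ - s * β) * ‖a.1‖ ^ 2
      + ∑ i, (σ⁻¹ - s⁻¹) * w i * ‖a.2 i‖ ^ 2 ≤ primalDualForm B w σ τ a a := by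
    intro a
    have h1 : (τ⁻¹ - s * β) * ‖a.1‖ ^ 2 = τ⁻¹ * ‖a.1‖ ^ 2
        - ∑ i, w i * (s * ‖B i‖ ^ 2 * ‖a.1‖ ^ 2) := by
      rw [sub_mul, hβ, Finset.mul_sum, Finset.sum_mul]
      congr 1
      exact Finset.sum_congr rfl fun i _ => by ring
    rw [h1, primalDualForm, real_inner_self_eq_norm_sq, sub_add_eq_add_sub, add_sub_assoc,
      ← Finset.sum_sub_distrib]
    gcongr with i
    rw [real_inner_self_eq_norm_sq]
    have h2 : ⟪B i a.1, a.2 i⟫ ≤ ‖B i‖ * ‖a.1‖ * ‖a.2 i‖ :=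
      (real_inner_le_norm _ _).trans (by gcongr; exact (B i).le_opNorm _)
    have h3 : 2 * (‖B i‖ * ‖a.1‖ * ‖a.2 i‖)
        ≤ s * ‖B i‖ ^ 2 * ‖a.1‖ ^ 2 + s⁻¹ * ‖a.2 i‖ ^ 2 := by
      have h4 := mul_nonneg (inv_nonneg.2 hs0.le) (sq_nonneg (s * (‖B i‖ * ‖a.1‖) - ‖a.2 i‖))
      have h5 : s⁻¹ * (s * (‖B i‖ * ‖a.1‖) - ‖a.2 i‖) ^ 2
          = s * ‖B i‖ ^ 2 * ‖a.1‖ ^ 2 + s⁻¹ * ‖a.2 i‖ ^ 2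
            - 2 * (‖B i‖ * ‖a.1‖ * ‖a.2 i‖) := by
        field_simp
        ring
      linarith
    have h6 := mul_le_mul_of_nonneg_left (h3.trans' (mul_le_mul_of_nonneg_left h2 zero_le_two))
      (hw i).le
    linarith
  obtain ⟨c, hc0, hcw, hc⟩ : ∃ c > 0, (∀ i, c ≤ (σ⁻¹ - s⁻¹) * w i) ∧ c ≤ τ⁻¹ - s * β := by
    -- `none` stands for the primal coefficient, so the minimum exists even for `m = 0`.
    have hpos : ∀ o : Option (Fin m),
        0 < o.elim (τ⁻¹ - s * β) fun i => (σ⁻¹ - s⁻¹) * w i := by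
      rintro (_ | i)
      · exact hc1
      · exact mul_pos hc2 (hw i)
    obtain ⟨o, ho⟩ := Finite.exists_min fun o : Option (Fin m) =>
      o.elim (τ⁻¹ - s * β) fun i => (σ⁻¹ - s⁻¹) * w i
    exact ⟨_, hpos o, fun i => ho (some i), ho none⟩
  have hsum : ∀ a : H × ∀ i, G i, 0 ≤ ∑ i, (σ⁻¹ - s⁻¹) * w i * ‖a.2 i‖ ^ 2 := fun a =>
    Finset.sum_nonneg fun i _ => mul_nonneg (mul_nonneg hc2.le (hw i).le) (sq_nonneg _)
  refine ⟨c, hc0, fun a => ?_⟩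
  have h0 : 0 ≤ primalDualForm B w σ τ a a :=
    (key a).trans' (add_nonneg (mul_nonneg hc1.le (sq_nonneg _)) (hsum a))
  have h1 : ‖a‖ ≤ √(primalDualForm B w σ τ a a / c) := by
    rw [Prod.norm_def, sup_le_iff, pi_norm_le_iff_of_nonneg (Real.sqrt_nonneg _)]
    refine ⟨Real.le_sqrt_of_sq_le ?_, fun i => Real.le_sqrt_of_sq_le ?_⟩
    · rw [le_div_iff₀ hc0]
      nlinarith [key a, hsum a, mul_le_mul_of_nonneg_right hc (sq_nonneg ‖a.1‖)]
    · rw [le_div_iff₀ hc0]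
      have h2 := Finset.single_le_sum (f := fun i => (σ⁻¹ - s⁻¹) * w i * ‖a.2 i‖ ^ 2)
        (fun i _ => mul_nonneg (mul_nonneg hc2.le (hw i).le) (sq_nonneg _)) (Finset.mem_univ i)
      have h3 := mul_le_mul_of_nonneg_right (hcw i) (sq_nonneg ‖a.2 i‖)
      have h4 := mul_nonneg hc1.le (sq_nonneg ‖a.1‖)
      linarith [key a]
  have h2 : ‖a‖ ^ 2 ≤ primalDualForm B w σ τ a a / c := by
    calc ‖a‖ ^ 2 ≤ √(primalDualForm B w σ τ a a / c) ^ 2 := by gcongr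
      _ = _ := Real.sq_sqrt (div_nonneg h0 hc0.le)
  rw [le_div_iff₀ hc0] at h2
  linarith

/-- One primal-dual iteration is a proximal point step for the Lagrangian, in the metric
`primalDualForm`. -/
lemma IsInnerStep.exists_primalDualForm_le [CompleteSpace H] [∀ i, CompleteSpace (G i)]
    (hg : IsGammaZero g) (hh : ∀ i, IsGammaZero (h i))
    (hw : ∀ i, 0 < w i) (hγ : 0 < γ) (hσ : 0 < σ) (hτ : 0 < τ) {v x x' : H} {y y' : ∀ i, G i}
    (hstep : IsInnerStep g h B w γ σ τ v x y x' y') :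
    ∃ (α : ℝ) (β : Fin m → ℝ), g x' = α ∧ (∀ i, fenchelConj (h i) ((w i / γ) • y' i) = β i) ∧
      ∀ (z : H) (r : ℝ) (η : ∀ i, G i) (s : Fin m → ℝ), g z = r →
        (∀ i, fenchelConj (h i) ((w i / γ) • η i) = s i) →
        primalDualForm B w σ τ ((x, y) - (x', y')) ((z, η) - (x', y')) ≤
          (‖z - v‖ ^ 2 / 2 + γ * r + ∑ i, w i * ⟪B i z, y' i⟫ - γ * ∑ i, β i)
          - (‖x' - v‖ ^ 2 / 2 + γ * α + ∑ i, w i * ⟪B i x', η i⟫ - γ * ∑ i, s i) := by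
  obtain ⟨hx, hy⟩ := hstep
  have hcx : 0 < τ * γ / (1 + τ) := by positivity
  obtain ⟨α, hα⟩ := EReal.exists_coe_eq (hg.ne_bot x') (hx.ne_top hcx hg.exists_ne_top hg.ne_bot)
  have hcy : ∀ i, 0 < w i * σ / γ := fun i => div_pos (mul_pos (hw i) hσ) hγ
  have hy1 : ∀ i, IsProx (w i * σ / γ) (fenchelConj (h i))
      ((w i / γ) • (y i + σ • B i ((2 : ℝ) • x' - x))) ((w i / γ) • y' i) := by
    intro i
    obtain ⟨q, hq, hq'⟩ := hy i
    have : (w i / γ) • y' i = q := by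
      rw [hq', smul_smul, div_mul_div_cancel₀ hγ.ne', div_self (hw i).ne', one_smul]
    rwa [this]
  choose β hβ using fun i => EReal.exists_coe_eq ((hh i).fenchelConj_ne_bot ((w i / γ) • y' i))
    ((hy1 i).ne_top (hcy i) (hh i).fenchelConj.exists_ne_top (hh i).fenchelConj_ne_bot)
  refine ⟨α, β, hα, hβ, fun z r η s hr hs => ?_⟩
  set d := z - x' with hd
  -- The primal step is implicit in both `γ g` and `½ ‖· - v‖²`; completing the square gives the
  -- scaling by `1 + τ`, and the common factor `τ / (1 + τ)` cancels.
  have hxineq : γ * α + τ⁻¹ * ⟪x - x', d⟫ - ∑ i, w i * ⟪B i d, y i⟫ + ⟪v - x', d⟫ ≤ γ * r := by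
    have h1 := hx.add_inner_le hcx hg.convex hα hr.le
    have h2 : ⟪(1 + τ)⁻¹ • (x - τ • ∑ i, w i • (B i).adjoint (y i) + τ • v) - x', d⟫
        = (τ / (1 + τ)) *
          (τ⁻¹ * ⟪x - x', d⟫ - ∑ i, w i * ⟪B i d, y i⟫ + ⟪v - x', d⟫) := by
      have h3 : ⟪∑ i, w i • (B i).adjoint (y i), d⟫ = ∑ i, w i * ⟪B i d, y i⟫ := by
        rw [sum_inner]
        refine Finset.sum_congr rfl fun i _ => ?_
        rw [real_inner_smul_left, ContinuousLinearMap.adjoint_inner_left, real_inner_comm]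
      simp only [inner_sub_left, inner_add_left, real_inner_smul_left, h3]
      field_simp
      ring
    rw [← hd, h2] at h1
    have h4 : 0 < τ / (1 + τ) := by positivity
    have h5 : τ / (1 + τ) * (γ * α + (τ⁻¹ * ⟪x - x', d⟫ - ∑ i, w i * ⟪B i d, y i⟫
        + ⟪v - x', d⟫)) ≤ τ / (1 + τ) * (γ * r) := by
      rw [mul_add]
      linarith [mul_div_right_comm τ γ (1 + τ), h1,
        show τ * γ / (1 + τ) * α = τ / (1 + τ) * (γ * α) by ring,
        show τ * γ / (1 + τ) * r = τ / (1 + τ) * (γ * r) by ring]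
    linarith [le_of_mul_le_mul_left h5 h4]
  have hyineq : ∀ i, w i * σ⁻¹ * ⟪y i - y' i + σ • B i ((2 : ℝ) • x' - x), η i - y' i⟫
      ≤ γ * s i - γ * β i := by
    intro i
    have h1 := (hy1 i).add_inner_le (hcy i) (hh i).fenchelConj.convex (hβ i) (hs i).le
    rw [← smul_sub, ← smul_sub, real_inner_smul_left, inner_smul_right, add_sub_right_comm] at h1
    have hwi := hw i
    have h2 : 0 < w i * σ / γ ^ 2 := by positivity
    refine le_of_mul_le_mul_left ?_ h2
    have h3 : w i * σ / γ ^ 2 *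
          (w i * σ⁻¹ * ⟪y i - y' i + σ • B i ((2 : ℝ) • x' - x), η i - y' i⟫)
        = w i / γ * (w i / γ * ⟪y i - y' i + σ • B i ((2 : ℝ) • x' - x), η i - y' i⟫) := by
      field_simp
    have h4 : w i * σ / γ ^ 2 * (γ * s i - γ * β i)
        = w i * σ / γ * s i - w i * σ / γ * β i := by
      field_simp
    rw [h3, h4]
    linarith
  have hsum := Finset.sum_le_sum fun i (_ : i ∈ Finset.univ) => hyineq i
  rw [Finset.sum_sub_distrib, ← Finset.mul_sum, ← Finset.mul_sum] at hsum
  -- The extrapolated point supplies exactly the cross term that makes the bilinear form symmetric.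
  have hform : primalDualForm B w σ τ ((x, y) - (x', y')) ((z, η) - (x', y'))
      = τ⁻¹ * ⟪x - x', d⟫
        + (∑ i, w i * σ⁻¹ * ⟪y i - y' i + σ • B i ((2 : ℝ) • x' - x), η i - y' i⟫
        - ∑ i, w i * ⟪B i d, y i⟫ + ∑ i, w i * ⟪B i z, y' i⟫ - ∑ i, w i * ⟪B i x', η i⟫) := by
    rw [primalDualForm, ← Finset.sum_sub_distrib, ← Finset.sum_add_distrib,
      ← Finset.sum_sub_distrib]
    congr 1
    refine Finset.sum_congr rfl fun i _ => ?_
    simp only [Prod.snd_sub, Prod.fst_sub, Pi.sub_apply, map_sub, map_smul, inner_sub_left,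
      inner_sub_right, inner_add_left, real_inner_smul_left, hd]
    field_simp
    ring
  have hsq : ‖z - v‖ ^ 2 = ‖x' - v‖ ^ 2 - 2 * ⟪v - x', d⟫ + ‖d‖ ^ 2 := by
    rw [show z - v = (x' - v) + d by rw [hd]; abel, norm_add_sq_real,
      ← neg_sub v x', inner_neg_left]
    ring
  rw [hform, hsq]
  linarith [sq_nonneg ‖d‖]

/-- Fenchel-Young in each block, scaled by `γ`: the Lagrangian never exceeds the primal objective.
-/
lemma sum_inner_sub_le (hh : ∀ i, IsGammaZero (h i)) (hγ : 0 < γ) {x : H} {y : ∀ i, G i}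
    {t s : Fin m → ℝ} (ht : ∀ i, h i (B i x) = t i)
    (hs : ∀ i, fenchelConj (h i) ((w i / γ) • y i) = s i) :
    ∑ i, w i * ⟪B i x, y i⟫ - γ * ∑ i, s i ≤ γ * ∑ i, t i := by
  rw [Finset.mul_sum, Finset.mul_sum, ← Finset.sum_sub_distrib]
  refine Finset.sum_le_sum fun i _ => ?_
  have h1 := inner_le_of_fenchelConj_le (hh i).ne_bot (ht i) (hs i).le
  rw [inner_smul_right] at h1
  have h2 := mul_le_mul_of_nonneg_left h1 hγ.le
  rw [← mul_assoc, mul_div_cancel₀ _ hγ.ne'] at h2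
  linarith

/-- A bound of the Lagrangian at `p` uniform in the dual variable bounds the primal objective. -/
lemma exists_primal_le_of_forall_lagrangian_le [∀ i, CompleteSpace (G i)]
    (hg : IsGammaZero g) (hh : ∀ i, IsGammaZero (h i)) (hw : ∀ i, 0 < w i) (hγ : 0 < γ)
    {p : H} {c M : ℝ}
    (hM : ∀ (a : ℝ) (η : ∀ i, G i) (s : Fin m → ℝ), (a : EReal) < g p →
      (∀ i, fenchelConj (h i) ((w i / γ) • η i) = s i) →
      c + γ * a + ∑ i, w i * ⟪B i p, η i⟫ - γ * ∑ i, s i ≤ M) :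
    ∃ (r : ℝ) (t : Fin m → ℝ), g p = r ∧ (∀ i, h i (B i p) = t i) ∧
      c + γ * r + γ * ∑ i, t i ≤ M := by
  obtain ⟨t, ht, hsum⟩ := EReal.exists_coe_sum_le
    -- Real numbers below the `hᵢ(Bᵢ p)` are exceeded by affine minorants, whose rescaled slopes
    -- serve as the dual variable.
    (c := fun o : Option (Fin m) => o.elim (g p) fun i => h i (B i p)) (M := (M - c) / γ) (by
      rintro (_ | i)
      exacts [hg.ne_bot _, (hh i).ne_bot _]) (by
      intro a ha
      choose q b hq hab using fun i => (hh i).exists_lt_inner_sub (ha (some i))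
      choose s hs using fun i => EReal.exists_coe_eq ((hh i).fenchelConj_ne_bot (q i))
        ((hq i).trans_lt (EReal.coe_lt_top _)).ne
      have h1 := hM (a none) (fun i => (γ / w i) • q i) s (ha none) fun i => by
        rw [smul_smul, div_mul_div_cancel₀ hγ.ne', div_self (hw i).ne', one_smul, hs]
      have h2 : γ * ∑ i, a (some i) ≤ ∑ i, w i * ⟪B i p, (γ / w i) • q i⟫ - γ * ∑ i, s i := by
        rw [Finset.mul_sum, Finset.mul_sum, ← Finset.sum_sub_distrib]
        refine Finset.sum_le_sum fun i _ => ?_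
        have h3 := hq i
        rw [hs, EReal.coe_le_coe_iff] at h3
        rw [inner_smul_right, ← mul_assoc, mul_div_cancel₀ _ (hw i).ne', ← mul_sub]
        exact mul_le_mul_of_nonneg_left (by linarith [hab i]) hγ.le
      rw [Fintype.sum_option, le_div_iff₀ hγ]
      linarith)
  rw [Fintype.sum_option, le_div_iff₀ hγ] at hsum
  exact ⟨t none, fun i => t (some i), ht none, fun i => ht (some i), by linarith⟩

/-- A real bound on the gap excludes infinite primal and dual values, so each summand is real and
the infimum unfolds into an inequality for every `z`. Later gap estimates can thus be made in `ℝ`.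
-/
lemma innerGap_le_coe_iff (hg : IsGammaZero g) (hh : ∀ i, IsGammaZero (h i)) (hγ : 0 < γ)
    {v p : H} {q : ∀ i, G i} {e : ℝ} :
    innerGap g h B w γ v p q ≤ e ↔ ∃ (r : ℝ) (t s : Fin m → ℝ), g p = r ∧
      (∀ i, h i (B i p) = t i) ∧ (∀ i, fenchelConj (h i) ((w i / γ) • q i) = s i) ∧
      ∀ (z : H) (ρ : ℝ), g z = ρ → ‖p - v‖ ^ 2 / 2 + γ * r + γ * ∑ i, t i - e ≤
        ‖z - v‖ ^ 2 / 2 + γ * ρ + ∑ i, w i * ⟪B i z, q i⟫ - γ * ∑ i, s i := by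
  have hhb : ∑ i, h i (B i p) ≠ ⊥ := EReal.finsetSum_ne_bot _ fun i => (hh i).ne_bot _
  have hcb : ∑ i, fenchelConj (h i) ((w i / γ) • q i) ≠ ⊥ :=
    EReal.finsetSum_ne_bot _ fun i => (hh i).fenchelConj_ne_bot _
  obtain ⟨x₀, hx₀⟩ := hg.exists_ne_top
  obtain ⟨r₀, hr₀⟩ := EReal.exists_coe_eq (hg.ne_bot x₀) hx₀
  set A := ⨅ x, ((‖x - v‖ ^ 2 / 2 + ∑ i, w i * ⟪B i x, q i⟫ : ℝ) : EReal) + (γ : EReal) * g x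
    with hA
  have hAle : ∀ (z : H) (ρ : ℝ), g z = ρ →
      A ≤ ((‖z - v‖ ^ 2 / 2 + ∑ i, w i * ⟪B i z, q i⟫ + γ * ρ : ℝ) : EReal) := by
    intro z ρ hρ
    refine (iInf_le _ z).trans ?_
    rw [hρ, ← EReal.coe_mul, ← EReal.coe_add]
  have hAtop : A ≠ ⊤ := ((hAle x₀ r₀ hr₀).trans_lt (EReal.coe_lt_top _)).ne
  have hC := EReal.coe_mul_ne_bot hγ hcb
  have hDtop : A - (γ : EReal) * ∑ i, fenchelConj (h i) ((w i / γ) • q i) ≠ ⊤ := by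
    rw [sub_eq_add_neg]
    exact EReal.add_ne_top hAtop (by simpa using hC)
  rw [innerGap, innerDual, ← hA, innerPrimal]
  constructor
  · intro hgap
    have hP : ((‖p - v‖ ^ 2 / 2 : ℝ) : EReal) + (γ : EReal) * g p
        + (γ : EReal) * ∑ i, h i (B i p) ≠ ⊤ := by
      intro hP
      rw [hP, sub_eq_add_neg, EReal.top_add_of_ne_bot (by simpa using hDtop), top_le_iff] at hgap
      exact EReal.coe_ne_top _ hgap
    have h1 : ((‖p - v‖ ^ 2 / 2 : ℝ) : EReal) + (γ : EReal) * g p ≠ ⊥ :=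
      EReal.add_ne_bot_iff.2 ⟨EReal.coe_ne_bot _, EReal.coe_mul_ne_bot hγ (hg.ne_bot p)⟩
    have h2 := EReal.coe_mul_ne_bot hγ hhb
    rw [EReal.add_ne_top_iff_ne_top₂ h1 h2, EReal.add_ne_top_iff_ne_top₂ (EReal.coe_ne_bot _)
      (EReal.coe_mul_ne_bot hγ (hg.ne_bot p))] at hP
    obtain ⟨r, hr⟩ := EReal.exists_coe_eq (hg.ne_bot p) (EReal.coe_mul_ne_top hγ hP.1.2)
    choose t ht using fun i => EReal.exists_coe_eq ((hh i).ne_bot (B i p))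
      (EReal.finsetSum_ne_top (fun i => (hh i).ne_bot (B i p)) (EReal.coe_mul_ne_top hγ hP.2) i
        (Finset.mem_univ i))
    have hD : A - (γ : EReal) * ∑ i, fenchelConj (h i) ((w i / γ) • q i) ≠ ⊥ := by
      intro hD
      rw [hD, EReal.sub_bot (EReal.add_ne_bot_iff.2 ⟨h1, h2⟩), top_le_iff] at hgap
      exact EReal.coe_ne_top _ hgap
    rw [sub_eq_add_neg, EReal.add_ne_bot_iff] at hD
    have hC' : (γ : EReal) * ∑ i, fenchelConj (h i) ((w i / γ) • q i) ≠ ⊤ := by simpa using hD.2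
    choose s hs using fun i => EReal.exists_coe_eq ((hh i).fenchelConj_ne_bot ((w i / γ) • q i))
      (EReal.finsetSum_ne_top (fun i => (hh i).fenchelConj_ne_bot _)
        (EReal.coe_mul_ne_top hγ hC') i (Finset.mem_univ i))
    obtain ⟨a, ha⟩ := EReal.exists_coe_eq hD.1 hAtop
    refine ⟨r, t, s, hr, ht, hs, fun z ρ hρ => ?_⟩
    have h3 := hAle z ρ hρ
    simp only [ha, hr, ht, hs, ← EReal.coe_finsetSum, ← EReal.coe_mul, ← EReal.coe_add,
      ← EReal.coe_sub, EReal.coe_le_coe_iff] at hgap h3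
    linarith
  · rintro ⟨r, t, s, hr, ht, hs, hle⟩
    have h3 : ((‖p - v‖ ^ 2 / 2 + γ * r + γ * ∑ i, t i - e + γ * ∑ i, s i : ℝ) : EReal) ≤ A := by
      refine le_iInf fun z => ?_
      rcases eq_or_ne (g z) ⊤ with hz | hz
      · rw [hz, EReal.coe_mul_top_of_pos hγ, EReal.add_top_of_ne_bot (EReal.coe_ne_bot _)]
        exact le_top
      obtain ⟨ρ, hρ⟩ := EReal.exists_coe_eq (hg.ne_bot z) hz
      rw [hρ, ← EReal.coe_mul, ← EReal.coe_add, EReal.coe_le_coe_iff]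
      linarith [hle z ρ hρ]
    obtain ⟨a, ha⟩ := EReal.exists_coe_eq
      (ne_bot_of_le_ne_bot (EReal.coe_ne_bot _) h3) hAtop
    simp only [ha, hr, ht, hs, ← EReal.coe_finsetSum, ← EReal.coe_mul, ← EReal.coe_add,
      ← EReal.coe_sub, EReal.coe_le_coe_iff] at h3 ⊢
    linarith

/-- Weak duality. -/
lemma innerGap_nonneg (hg : IsGammaZero g) (hh : ∀ i, IsGammaZero (h i)) (hγ : 0 < γ)
    (v p : H) (q : ∀ i, G i) : 0 ≤ innerGap g h B w γ v p q := by
  by_contra! hlt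
  obtain ⟨e, he, he0⟩ := EReal.lt_iff_exists_real_btwn.1 hlt
  obtain ⟨r, t, s, hr, ht, hs, hle⟩ := (innerGap_le_coe_iff hg hh hγ).1 he.le
  have h1 := hle p r hr
  have h2 := sum_inner_sub_le hh hγ ht hs
  have h3 : e < 0 := by exact_mod_cast he0
  linarith

lemma innerGap_eq_zero_iff (hg : IsGammaZero g) (hh : ∀ i, IsGammaZero (h i)) (hγ : 0 < γ)
    {v p : H} {q : ∀ i, G i} :
    innerGap g h B w γ v p q = 0 ↔ innerGap g h B w γ v p q ≤ (0 : ℝ) :=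
  ⟨fun h0 => h0.le.trans_eq EReal.coe_zero.symm, fun hle =>
    le_antisymm (hle.trans_eq EReal.coe_zero) (innerGap_nonneg hg hh hγ v p q)⟩

end InnerProblem

/-- A sequence that is Fejér monotone with respect to a coercive gauge `q`, with increments
controlled by `q`, converges as soon as its cluster points lie in the target set. -/
lemma exists_tendsto_of_fejer {E : Type*} [NormedAddCommGroup E] [ProperSpace E]
    {q : E → ℝ} (hqc : Continuous q) (hq0 : q 0 = 0) {c : ℝ} (hc : 0 < c)
    (hq : ∀ a, c * ‖a‖ ^ 2 ≤ q a) {Z : Set E} (hZ : Z.Nonempty) {ζ : ℕ → E}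
    (hF : ∀ p ∈ Z, ∀ j, q (ζ (j + 1) - p) + q (ζ j - ζ (j + 1)) ≤ q (ζ j - p))
    (hcl : ∀ (φ : ℕ → ℕ) (a : E), StrictMono φ → Tendsto (fun n => ζ (φ n)) atTop (𝓝 a) →
      Tendsto (fun n => ζ (φ n + 1)) atTop (𝓝 a) → a ∈ Z) :
    ∃ a ∈ Z, Tendsto ζ atTop (𝓝 a) := by
  have hqnn : ∀ a, 0 ≤ q a := fun a => (hq a).trans' (by positivity)
  have hto0 : ∀ η : ℕ → E, Tendsto (fun n => q (η n)) atTop (𝓝 0) → Tendsto η atTop (𝓝 0) := by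
    intro η hη
    rw [tendsto_zero_iff_norm_tendsto_zero]
    have h1 : Tendsto (fun n => ‖η n‖ ^ 2) atTop (𝓝 0) := by
      have h2 := hη.const_mul c⁻¹
      rw [mul_zero] at h2
      refine squeeze_zero (fun n => sq_nonneg _) (fun n => ?_) h2
      rw [le_inv_mul_iff₀ hc]
      exact hq _
    simpa using h1.sqrt
  have hconv : ∀ p ∈ Z, ∃ l, Tendsto (fun j => q (ζ j - p)) atTop (𝓝 l) := fun p hp =>
    ⟨_, tendsto_atTop_ciInf (antitone_nat_of_succ_le fun j => by
      linarith [hF p hp j, hqnn (ζ j - ζ (j + 1))]) ⟨0, by rintro _ ⟨j, rfl⟩; exact hqnn _⟩⟩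
  obtain ⟨p, hp⟩ := hZ
  obtain ⟨l, hl⟩ := hconv p hp
  have hinc : Tendsto (fun j => ζ j - ζ (j + 1)) atTop (𝓝 0) := by
    refine hto0 _ ?_
    have h1 := hl.sub (hl.comp (tendsto_add_atTop_nat 1))
    rw [sub_self] at h1
    refine squeeze_zero (fun j => hqnn _) (fun j => ?_) h1
    simp only [Function.comp]
    linarith [hF p hp j]
  obtain ⟨R, hR⟩ := hl.bddAbove_range
  obtain ⟨a, -, φ, hφ, ha⟩ := tendsto_subseq_of_bounded
    (Metric.isBounded_closedBall (x := p) (r := √(R / c))) (x := ζ) fun j => by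
      rw [Metric.mem_closedBall, dist_eq_norm]
      refine Real.le_sqrt_of_sq_le ?_
      rw [le_div_iff₀ hc, mul_comm]
      exact (hq _).trans (hR ⟨j, rfl⟩)
  have ha' : Tendsto (fun n => ζ (φ n + 1)) atTop (𝓝 a) := by
    simpa using ha.sub (hinc.comp hφ.tendsto_atTop)
  have haZ := hcl φ a hφ ha ha'
  refine ⟨a, haZ, ?_⟩
  obtain ⟨l', hl'⟩ := hconv a haZ
  have h1 : Tendsto (fun n => q (ζ (φ n) - a)) atTop (𝓝 0) := by
    have h2 := (hqc.tendsto 0).comp (by simpa using ha.sub_const a :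
      Tendsto (fun n => ζ (φ n) - a) atTop (𝓝 0))
    rwa [hq0] at h2
  rw [tendsto_nhds_unique (hl'.comp hφ.tendsto_atTop) h1] at hl'
  simpa using (hto0 _ hl').add_const a

/-! ### Convergence of the inner iteration. -/

section InnerProblem

variable {m : ℕ} {H : Type*} [NormedAddCommGroup H] [InnerProductSpace ℝ H] [CompleteSpace H]
  {G : Fin m → Type*} [∀ i, NormedAddCommGroup (G i)] [∀ i, InnerProductSpace ℝ (G i)]
  [∀ i, CompleteSpace (G i)]
  {g : H → EReal} {h : ∀ i, G i → EReal} {B : ∀ i, H →L[ℝ] G i} {w : Fin m → ℝ} {γ σ τ : ℝ}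

/-- Cluster points of the primal-dual iteration with vanishing increments have zero gap. -/
lemma innerGap_eq_zero_of_cluster (hg : IsGammaZero g) (hh : ∀ i, IsGammaZero (h i))
    (hw : ∀ i, 0 < w i) (hγ : 0 < γ) (hσ : 0 < σ) (hτ : 0 < τ) {v : H} {ξ : ℕ → H}
    {η : ℕ → ∀ i, G i}
    (hstep : ∀ j, IsInnerStep g h B w γ σ τ v (ξ j) (η j) (ξ (j + 1)) (η (j + 1)))
    {φ : ℕ → ℕ} {p : H} {q : ∀ i, G i}
    (h1 : Tendsto (fun n => (ξ (φ n), η (φ n))) atTop (𝓝 (p, q)))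
    (h2 : Tendsto (fun n => (ξ (φ n + 1), η (φ n + 1))) atTop (𝓝 (p, q))) :
    innerGap g h B w γ v p q = 0 := by
  choose α β hα hβ hle using fun j => (hstep j).exists_primalDualForm_le hg hh hw hγ hσ hτ
  have hform : ∀ a : H × ∀ i, G i, Tendsto (fun n => primalDualForm B w σ τ
      ((ξ (φ n), η (φ n)) - (ξ (φ n + 1), η (φ n + 1))) (a - (ξ (φ n + 1), η (φ n + 1))))
      atTop (𝓝 0) := by
    intro a
    have h3 := ((continuous_primalDualForm (B := B) (w := w) (σ := σ) (τ := τ)).tendsto _).comp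
      ((h1.sub h2).prodMk_nhds (h2.const_sub a))
    have h4 : primalDualForm B w σ τ ((p, q) - (p, q)) (a - (p, q)) = 0 := by
      rw [primalDualForm_sub_left, sub_self]
    rw [h4] at h3
    exact h3
  have hpt : Tendsto (fun n => ξ (φ n + 1)) atTop (𝓝 p) := h2.fst_nhds
  have hqt : Tendsto (fun n => η (φ n + 1)) atTop (𝓝 q) := h2.snd_nhds
  -- Finiteness at the limit is not yet known, so the saddle inequality is first proved with real
  -- minorants `a`, `b`, which lower semicontinuity puts below the values along the subsequence.
  have hlim : ∀ (a : ℝ) (b : Fin m → ℝ) (z : H) (r : ℝ) (y : ∀ i, G i) (s : Fin m → ℝ),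
      (a : EReal) < g p → (∀ i, (b i : EReal) < fenchelConj (h i) ((w i / γ) • q i)) →
      g z = r → (∀ i, fenchelConj (h i) ((w i / γ) • y i) = s i) →
      ‖p - v‖ ^ 2 / 2 + γ * a + ∑ i, w i * ⟪B i p, y i⟫ - γ * ∑ i, s i ≤
        ‖z - v‖ ^ 2 / 2 + γ * r + ∑ i, w i * ⟪B i z, q i⟫ - γ * ∑ i, b i := by
    intro a b z r y s ha hb hr hs
    have hea : ∀ᶠ n in atTop, a < α (φ n) := by
      filter_upwards [hpt.eventually (hg.lsc p a ha)] with n hn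
      rwa [hα, gt_iff_lt, EReal.coe_lt_coe_iff] at hn
    have heb : ∀ᶠ n in atTop, ∀ i, b i < β (φ n) i := by
      rw [eventually_all]
      intro i
      have hqi : Tendsto (fun n => (w i / γ) • η (φ n + 1) i) atTop (𝓝 ((w i / γ) • q i)) :=
        (hqt.apply_nhds i).const_smul _
      filter_upwards [hqi.eventually ((hh i).fenchelConj.lsc _ (b i) (hb i))] with n hn
      rwa [hβ, gt_iff_lt, EReal.coe_lt_coe_iff] at hn
    have hL : Tendsto (fun n => primalDualForm B w σ τ
        ((ξ (φ n), η (φ n)) - (ξ (φ n + 1), η (φ n + 1)))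
          ((z, y) - (ξ (φ n + 1), η (φ n + 1)))
        + (‖ξ (φ n + 1) - v‖ ^ 2 / 2 + γ * a + ∑ i, w i * ⟪B i (ξ (φ n + 1)), y i⟫
          - γ * ∑ i, s i)) atTop
        (𝓝 (0 + (‖p - v‖ ^ 2 / 2 + γ * a + ∑ i, w i * ⟪B i p, y i⟫ - γ * ∑ i, s i))) := by
      refine (hform (z, y)).add ?_
      have hcont : Continuous fun x : H =>
        ‖x - v‖ ^ 2 / 2 + γ * a + ∑ i, w i * ⟪B i x, y i⟫ - γ * ∑ i, s i := by fun_prop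
      exact (hcont.tendsto p).comp hpt
    have hR : Tendsto (fun n => ‖z - v‖ ^ 2 / 2 + γ * r + ∑ i, w i * ⟪B i z, η (φ n + 1) i⟫
        - γ * ∑ i, b i) atTop
        (𝓝 (‖z - v‖ ^ 2 / 2 + γ * r + ∑ i, w i * ⟪B i z, q i⟫ - γ * ∑ i, b i)) := by
      have hcont : Continuous fun x : ∀ i, G i =>
        ‖z - v‖ ^ 2 / 2 + γ * r + ∑ i, w i * ⟪B i z, x i⟫ - γ * ∑ i, b i := by fun_prop
      exact (hcont.tendsto q).comp hqt
    rw [zero_add] at hL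
    refine le_of_tendsto_of_tendsto hL hR ?_
    filter_upwards [hea, heb] with n hna hnb
    have h3 := hle (φ n) z r y s hr hs
    have h4 := mul_lt_mul_of_pos_left hna hγ
    have h5 := mul_le_mul_of_nonneg_left
      (Finset.sum_le_sum fun i (_ : i ∈ Finset.univ) => (hnb i).le) hγ.le
    linarith
  have hfin : ∀ (z : H) (r : ℝ) (y : ∀ i, G i) (s : Fin m → ℝ), g z = r →
      (∀ i, fenchelConj (h i) ((w i / γ) • y i) = s i) →
      ∃ t : Option (Fin m) → ℝ, (∀ o : Option (Fin m),
        o.elim (g p) (fun i => fenchelConj (h i) ((w i / γ) • q i)) = t o) ∧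
        ∑ o, t o ≤ (‖z - v‖ ^ 2 / 2 + γ * r + ∑ i, w i * ⟪B i z, q i⟫
          - (‖p - v‖ ^ 2 / 2 + ∑ i, w i * ⟪B i p, y i⟫ - γ * ∑ i, s i)) / γ := by
    intro z r y s hr hs
    refine EReal.exists_coe_sum_le ?_ fun a ha => ?_
    · rintro (_ | i)
      exacts [hg.ne_bot _, (hh i).fenchelConj_ne_bot _]
    · have h3 := hlim (a none) (fun i => a (some i)) z r y s (ha none) (fun i => ha (some i)) hr hs
      rw [Fintype.sum_option, le_div_iff₀ hγ]
      linarith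
  -- After one step the iterates have finite `g` and conjugate values, so they are admissible test
  -- points.
  obtain ⟨t, ht, -⟩ := hfin (ξ 1) (α 0) (η 1) (β 0) (hα 0) (hβ 0)
  have hgp : g p = t none := ht none
  have hsad : ∀ (z : H) (r : ℝ) (y : ∀ i, G i) (s : Fin m → ℝ), g z = r →
      (∀ i, fenchelConj (h i) ((w i / γ) • y i) = s i) →
      ‖p - v‖ ^ 2 / 2 + γ * t none + ∑ i, w i * ⟪B i p, y i⟫ - γ * ∑ i, s i ≤
        ‖z - v‖ ^ 2 / 2 + γ * r + ∑ i, w i * ⟪B i z, q i⟫ - γ * ∑ i, t (some i) := by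
    intro z r y s hr hs
    obtain ⟨t', ht', hsum⟩ := hfin z r y s hr hs
    have htt : t' = t := funext fun o => EReal.coe_injective ((ht' o).symm.trans (ht o))
    rw [htt, Fintype.sum_option, le_div_iff₀ hγ] at hsum
    linarith
  have hprim : ∀ (z : H) (r : ℝ), g z = r → ∃ (ρ : ℝ) (T : Fin m → ℝ), g p = ρ ∧
      (∀ i, h i (B i p) = T i) ∧ ‖p - v‖ ^ 2 / 2 + γ * ρ + γ * ∑ i, T i ≤
        ‖z - v‖ ^ 2 / 2 + γ * r + ∑ i, w i * ⟪B i z, q i⟫ - γ * ∑ i, t (some i) := by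
    intro z r hr
    refine exists_primal_le_of_forall_lagrangian_le hg hh hw hγ fun a y s ha hs => ?_
    rw [hgp, EReal.coe_lt_coe_iff] at ha
    linarith [hsad z r y s hr hs, mul_lt_mul_of_pos_left ha hγ]
  obtain ⟨ρ, T, hρ, hT, -⟩ := hprim (ξ 1) (α 0) (hα 0)
  rw [innerGap_eq_zero_iff hg hh hγ, innerGap_le_coe_iff hg hh hγ]
  refine ⟨ρ, T, fun i => t (some i), hρ, hT, fun i => ht (some i), fun z r hr => ?_⟩
  obtain ⟨ρ', T', hρ', hT', hle'⟩ := hprim z r hr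
  have e1 : ρ' = ρ := EReal.coe_injective (hρ'.symm.trans hρ)
  have e2 : T' = T := funext fun i => EReal.coe_injective ((hT' i).symm.trans (hT i))
  rw [e1, e2] at hle'
  linarith

/-- The inner iterates converge to a primal-dual solution if there is one. -/
theorem exists_tendsto_innerGap_eq_zero [FiniteDimensional ℝ H] [∀ i, FiniteDimensional ℝ (G i)]
    (hg : IsGammaZero g) (hh : ∀ i, IsGammaZero (h i))
    (hw : ∀ i, 0 < w i) (hγ : 0 < γ) (hσ : 0 < σ) (hτ : 0 < τ)
    (hστ : σ * τ * ∑ i, w i * ‖B i‖ ^ 2 < 1) {v : H} {ξ : ℕ → H} {η : ℕ → ∀ i, G i}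
    (hstep : ∀ j, IsInnerStep g h B w γ σ τ v (ξ j) (η j) (ξ (j + 1)) (η (j + 1)))
    (hsol : ∃ p q, innerGap g h B w γ v p q = 0) :
    ∃ p q, innerGap g h B w γ v p q = 0 ∧ Tendsto ξ atTop (𝓝 p) ∧ Tendsto η atTop (𝓝 q) := by
  have : ProperSpace (H × ∀ i, G i) := FiniteDimensional.proper_real _
  obtain ⟨c, hc, hcoer⟩ := exists_le_primalDualForm_self hw hσ hτ hστ
  obtain ⟨p₀, q₀, hpq⟩ := hsol
  obtain ⟨a, ha, hlim⟩ := exists_tendsto_of_fejer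
    (q := fun a : H × ∀ i, G i => primalDualForm B w σ τ a a)
    (Z := {a | innerGap g h B w γ v a.1 a.2 = 0}) (ζ := fun j => (ξ j, η j))
    (continuous_primalDualForm.comp (continuous_id.prodMk continuous_id))
    (by simp [primalDualForm]) hc hcoer ⟨(p₀, q₀), hpq⟩
    (by
      rintro ⟨p, q⟩ hpq j
      obtain ⟨α, β, hα, hβ, hle⟩ := (hstep j).exists_primalDualForm_le hg hh hw hγ hσ hτ
      obtain ⟨r, t, s, hr, ht, hs, hgap⟩ := (innerGap_le_coe_iff hg hh hγ).1
        ((innerGap_eq_zero_iff hg hh hγ).1 hpq)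
      have h1 := hle p r q s hr hs
      have h2 := hgap _ α hα
      have h3 := sum_inner_sub_le hh hγ ht hβ
      have h4 := two_mul_primalDualForm (B := B) (w := w) (σ := σ) (τ := τ)
        (ξ j, η j) (ξ (j + 1), η (j + 1)) (p, q)
      rw [primalDualForm_sub_swap (p, q) (ξ (j + 1), η (j + 1))] at h4
      dsimp only at h2 h3
      linarith)
    (fun φ a _ h1 h2 => innerGap_eq_zero_of_cluster hg hh hw hγ hσ hτ hstep h1 h2)
  exact ⟨a.1, a.2, ha, hlim.fst_nhds, hlim.snd_nhds⟩

end InnerProblem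

/-- A nonnegative real sequence cannot eventually decrease by a fixed amount. -/
lemma not_eventually_le_sub {b : ℕ → ℝ} (hb : ∀ j, 0 ≤ b j) {δ : ℝ} (hδ : 0 < δ) :
    ¬ ∀ᶠ j in atTop, b (j + 1) ≤ b j - δ := by
  intro hev
  obtain ⟨N, hN⟩ := eventually_atTop.1 hev
  have h1 : ∀ k : ℕ, b (N + k) ≤ b N - k * δ := by
    intro k
    induction k with
    | zero => simp
    | succ k ih =>
      have := hN (N + k) (Nat.le_add_right N k)
      rw [← add_assoc]
      push_cast
      linarith
  obtain ⟨k, hk⟩ := exists_nat_gt (b N / δ)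
  rw [div_lt_iff₀ hδ] at hk
  linarith [h1 k, hb (N + k)]

/-! ### From inner accuracy to errors of the outer proximal step. -/

section CompositePenalty

variable {m : ℕ} {H : Type*} [NormedAddCommGroup H] [InnerProductSpace ℝ H]
  {G : Fin m → Type*} [∀ i, NormedAddCommGroup (G i)] [∀ i, InnerProductSpace ℝ (G i)]
  {g : H → EReal} {h : ∀ i, G i → EReal} {B : ∀ i, H →L[ℝ] G i} {w : Fin m → ℝ} {γ σ τ : ℝ}

/-- The nonsmooth part `g(x) + ∑ᵢ hᵢ(Bᵢ x)` of the objective. -/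
noncomputable def compositePenalty (g : H → EReal) (h : ∀ i, G i → EReal)
    (B : ∀ i, H →L[ℝ] G i) (x : H) : EReal :=
  g x + ∑ i, h i (B i x)

lemma compositePenalty_eq_coe {x : H} {r : ℝ} {t : Fin m → ℝ} (hr : g x = r)
    (ht : ∀ i, h i (B i x) = t i) : compositePenalty g h B x = ((r + ∑ i, t i : ℝ) : EReal) := by
  rw [compositePenalty, hr, EReal.coe_add, EReal.coe_finsetSum]
  simp only [ht]

lemma compositePenalty_ne_bot (hg : IsGammaZero g) (hh : ∀ i, IsGammaZero (h i)) (x : H) :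
    compositePenalty g h B x ≠ ⊥ :=
  EReal.add_ne_bot_iff.2 ⟨hg.ne_bot x, EReal.finsetSum_ne_bot _ fun i => (hh i).ne_bot _⟩

lemma exists_coe_of_compositePenalty_ne_top (hg : IsGammaZero g) (hh : ∀ i, IsGammaZero (h i))
    {x : H} (hx : compositePenalty g h B x ≠ ⊤) :
    ∃ (r : ℝ) (t : Fin m → ℝ), g x = r ∧ ∀ i, h i (B i x) = t i := by
  rw [compositePenalty, EReal.add_ne_top_iff_ne_top₂ (hg.ne_bot x)
    (EReal.finsetSum_ne_bot _ fun i => (hh i).ne_bot _)] at hx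
  obtain ⟨r, hr⟩ := EReal.exists_coe_eq (hg.ne_bot x) hx.1
  choose t ht using fun i => EReal.exists_coe_eq ((hh i).ne_bot (B i x))
    (EReal.finsetSum_ne_top (fun i => (hh i).ne_bot (B i x)) hx.2 i (Finset.mem_univ i))
  exact ⟨r, t, hr, ht⟩

lemma isGammaZero_compositePenalty (hg : IsGammaZero g) (hh : ∀ i, IsGammaZero (h i))
    (hdom : ∃ x, compositePenalty g h B x ≠ ⊤) : IsGammaZero (compositePenalty g h B) where
  ne_bot := compositePenalty_ne_bot hg hh
  exists_ne_top := hdom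
  lsc := lowerSemicontinuous_add_of_ne_bot hg.lsc
    (lowerSemicontinuous_finsetSum_of_ne_bot
      (fun i => (hh i).lsc.comp (B i).continuous) (fun i x => (hh i).ne_bot _) _)
    hg.ne_bot fun x => EReal.finsetSum_ne_bot _ fun i => (hh i).ne_bot _
  convex := by
    rintro ⟨x, a⟩ hx ⟨x', a'⟩ hx' c d hc hd hcd
    simp only [Set.mem_ofPred_eq, Prod.fst_add, Prod.smul_fst, Prod.snd_add, Prod.smul_snd,
      smul_eq_mul] at hx hx' ⊢
    obtain ⟨r, t, hr, ht⟩ := exists_coe_of_compositePenalty_ne_top hg hh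
      (hx.trans_lt (EReal.coe_lt_top a)).ne
    obtain ⟨r', t', hr', ht'⟩ := exists_coe_of_compositePenalty_ne_top hg hh
      (hx'.trans_lt (EReal.coe_lt_top a')).ne
    rw [compositePenalty_eq_coe hr ht, EReal.coe_le_coe_iff] at hx
    rw [compositePenalty_eq_coe hr' ht', EReal.coe_le_coe_iff] at hx'
    have h1 : g (c • x + d • x') ≤ ((c * r + d * r' : ℝ) : EReal) :=
      hg.convex (x := (x, r)) hr.le (y := (x', r')) hr'.le hc hd hcd
    have h2 : ∀ i, h i (B i (c • x + d • x')) ≤ ((c * t i + d * t' i : ℝ) : EReal) := fun i => by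
      rw [map_add, map_smul, map_smul]
      exact (hh i).convex (x := (B i x, t i)) (ht i).le (y := (B i x', t' i)) (ht' i).le hc hd hcd
    refine (add_le_add h1 (Finset.sum_le_sum fun i _ => h2 i)).trans ?_
    rw [← EReal.coe_finsetSum, ← EReal.coe_add, EReal.coe_le_coe_iff, Finset.sum_add_distrib,
      ← Finset.mul_sum, ← Finset.mul_sum]
    linarith [mul_le_mul_of_nonneg_left hx hc, mul_le_mul_of_nonneg_left hx' hd]

/-- The primal-dual gap controls the distance to the primal solution. -/
lemma norm_sub_sq_le_of_innerGap_le (hg : IsGammaZero g) (hh : ∀ i, IsGammaZero (h i))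
    (hγ : 0 < γ) {v x p : H} {q : ∀ i, G i} {e : ℝ} (hgap : innerGap g h B w γ v x q ≤ e)
    (hp : IsProx γ (compositePenalty g h B) v p) : ‖x - p‖ ^ 2 ≤ 2 * e := by
  obtain ⟨r, t, s, hr, ht, hs, hle⟩ := (innerGap_le_coe_iff hg hh hγ).1 hgap
  have hx := compositePenalty_eq_coe hr ht
  have hΦ : IsGammaZero (compositePenalty g h B) :=
    isGammaZero_compositePenalty hg hh ⟨x, by rw [hx]; exact EReal.coe_ne_top _⟩
  obtain ⟨r', t', hr', ht'⟩ := exists_coe_of_compositePenalty_ne_top hg hh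
    (hp.ne_top hγ hΦ.exists_ne_top hΦ.ne_bot)
  -- Strong convexity puts the primal value at `x` at least `½ ‖x - p‖²` above that at `p`, while
  -- the latter dominates the Lagrangian at `(p, q)`.
  have h1 := hp.add_inner_le hγ hΦ.convex (compositePenalty_eq_coe hr' ht') hx.le
  have h2 := hle p r' hr'
  have h3 := sum_inner_sub_le hh hγ ht' hs
  have h4 : ‖x - v‖ ^ 2 = ‖p - v‖ ^ 2 - 2 * ⟪v - p, x - p⟫ + ‖x - p‖ ^ 2 := by
    rw [show x - v = (p - v) + (x - p) by abel, norm_add_sq_real, ← neg_sub v p, inner_neg_left]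
    ring
  rw [mul_add, mul_add] at h1
  linarith

/-- If the primal inner iterates converge, their limit solves the inner problem, even without a
dual solution. -/
lemma isProx_of_tendsto_inner [CompleteSpace H] [∀ i, CompleteSpace (G i)]
    (hg : IsGammaZero g) (hh : ∀ i, IsGammaZero (h i))
    (hw : ∀ i, 0 < w i) (hγ : 0 < γ) (hσ : 0 < σ) (hτ : 0 < τ)
    (hστ : σ * τ * ∑ i, w i * ‖B i‖ ^ 2 < 1) {v p : H} {ξ : ℕ → H} {η : ℕ → ∀ i, G i}
    (hstep : ∀ j, IsInnerStep g h B w γ σ τ v (ξ j) (η j) (ξ (j + 1)) (η (j + 1)))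
    (hξ : Tendsto ξ atTop (𝓝 p)) : IsProx γ (compositePenalty g h B) v p := by
  choose α β hα hβ hle using fun j => (hstep j).exists_primalDualForm_le hg hh hw hγ hσ hτ
  obtain ⟨c, hc, hcoer⟩ := exists_le_primalDualForm_self hw hσ hτ hστ
  have hξ' : Tendsto (fun j => ξ (j + 1)) atTop (𝓝 p) := hξ.comp (tendsto_add_atTop_nat 1)
  have key : ∀ (z : H) (r : ℝ) (t : Fin m → ℝ), g z = r → (∀ i, h i (B i z) = t i) →
      ∀ (a : ℝ) (y : ∀ i, G i) (s : Fin m → ℝ), (a : EReal) < g p →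
      (∀ i, fenchelConj (h i) ((w i / γ) • y i) = s i) →
      ‖p - v‖ ^ 2 / 2 + γ * a + ∑ i, w i * ⟪B i p, y i⟫ - γ * ∑ i, s i ≤
        ‖z - v‖ ^ 2 / 2 + γ * r + γ * ∑ i, t i := by
    intro z r t hr ht a y s ha hs
    -- If the Lagrangian at `(p, y)` exceeded the primal value at `z` by `δ`, the squared distance
    -- to `(z, y)` would eventually drop by `δ` at every step: lower semicontinuity and continuity
    -- cost at most `δ / 2`, and polarization doubles the rest.
    by_contra! hlt
    set δ := ‖p - v‖ ^ 2 / 2 + γ * a + ∑ i, w i * ⟪B i p, y i⟫ - γ * ∑ i, s i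
      - (‖z - v‖ ^ 2 / 2 + γ * r + γ * ∑ i, t i) with hδ
    have hδ0 : 0 < δ := by linarith
    refine not_eventually_le_sub
      (b := fun j => primalDualForm B w σ τ ((ξ j, η j) - (z, y)) ((ξ j, η j) - (z, y)))
      (fun j => (hcoer _).trans' (by positivity)) hδ0 ?_
    have hea : ∀ᶠ j in atTop, a < α j := by
      filter_upwards [hξ'.eventually (hg.lsc p a ha)] with j hj
      rwa [hα, gt_iff_lt, EReal.coe_lt_coe_iff] at hj
    have hcont : Continuous fun x : H =>
      ‖x - v‖ ^ 2 / 2 + γ * a + ∑ i, w i * ⟪B i x, y i⟫ - γ * ∑ i, s i := by fun_prop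
    have hev := ((hcont.tendsto p).comp hξ').eventually (lt_mem_nhds (sub_lt_self _ (half_pos hδ0)))
    filter_upwards [hea, hev] with j hja hjv
    simp only [Function.comp] at hjv
    have h1 := hle j z r y s hr hs
    have h2 := sum_inner_sub_le hh hγ ht (hβ j)
    have h3 := mul_lt_mul_of_pos_left hja hγ
    have h4 := two_mul_primalDualForm (B := B) (w := w) (σ := σ) (τ := τ)
      (ξ j, η j) (ξ (j + 1), η (j + 1)) (z, y)
    rw [primalDualForm_sub_swap (z, y) (ξ (j + 1), η (j + 1))] at h4
    have h5 : 0 ≤ primalDualForm B w σ τ ((ξ j, η j) - (ξ (j + 1), η (j + 1)))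
        ((ξ j, η j) - (ξ (j + 1), η (j + 1))) := (hcoer _).trans' (by positivity)
    linarith
  have hprim : ∀ (z : H) (r : ℝ) (t : Fin m → ℝ), g z = r → (∀ i, h i (B i z) = t i) →
      ∃ (ρ : ℝ) (T : Fin m → ℝ), g p = ρ ∧ (∀ i, h i (B i p) = T i) ∧
        ‖p - v‖ ^ 2 / 2 + γ * ρ + γ * ∑ i, T i ≤ ‖z - v‖ ^ 2 / 2 + γ * r + γ * ∑ i, t i :=
    fun z r t hr ht => exists_primal_le_of_forall_lagrangian_le hg hh hw hγ (key z r t hr ht)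
  intro z
  rcases eq_or_ne (compositePenalty g h B z) ⊤ with hz | hz
  · rw [hz, EReal.coe_mul_top_of_pos hγ, EReal.add_top_of_ne_bot (EReal.coe_ne_bot _)]
    exact le_top
  obtain ⟨r, t, hr, ht⟩ := exists_coe_of_compositePenalty_ne_top hg hh hz
  obtain ⟨ρ, T, hρ, hT, hle'⟩ := hprim z r t hr ht
  rw [compositePenalty_eq_coe hr ht, compositePenalty_eq_coe hρ hT, ← EReal.coe_mul,
    ← EReal.coe_mul, ← EReal.coe_add, ← EReal.coe_add, EReal.coe_le_coe_iff]
  linarith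

lemma compositeObjective_eq_add (f : H → ℝ) (x : H) :
    compositeObjective f g h B x = (f x : EReal) + compositePenalty g h B x :=
  add_assoc _ _ _

lemma isCompositeSolution_iff (hg : IsGammaZero g) (hh : ∀ i, IsGammaZero (h i)) {f : H → ℝ}
    {z : H} : IsCompositeSolution f g h B z ↔ compositePenalty g h B z ≠ ⊤ ∧
      ∀ x, (f z : EReal) + compositePenalty g h B z ≤ (f x : EReal) + compositePenalty g h B x := by
  simp only [IsCompositeSolution, compositeObjective_eq_add]
  rw [EReal.add_ne_top_iff_ne_top₂ (EReal.coe_ne_bot _) (compositePenalty_ne_bot hg hh z)]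
  simp

end CompositePenalty

/-! ### The main theorem. -/

theorem theorem4p5 {m : ℕ} {H : Type*} [NormedAddCommGroup H] [InnerProductSpace ℝ H]
    [CompleteSpace H] [FiniteDimensional ℝ H]
    {G : Fin m → Type*} [∀ i, NormedAddCommGroup (G i)] [∀ i, InnerProductSpace ℝ (G i)]
    [∀ i, CompleteSpace (G i)] [∀ i, FiniteDimensional ℝ (G i)]
    (f : H → ℝ) (g : H → EReal) (h : ∀ i, G i → EReal) (B : ∀ i, H →L[ℝ] G i)
    (L : ℝ) (hL : 0 < L)
    (hf_convex : ConvexOn ℝ Set.univ f) (hf_diff : Differentiable ℝ f)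
    (hf_lip : ∀ a b, ‖∇ f a - ∇ f b‖ ≤ L * ‖a - b‖)
    (hg : IsGammaZero g) (hh : ∀ i, IsGammaZero (h i))
    (hsol : ∃ z, IsCompositeSolution f g h B z)
    (w : Fin m → ℝ) (hw : ∀ i, 0 < w i) (hw_sum : ∑ i, w i = 1)
    (γ σ τ : ℝ) (hγ : 0 < γ) (hγL : γ < 2 / L) (hσ : 0 < σ) (hτ : 0 < τ)
    (hστ : σ * τ * ∑ i, w i * ‖B i‖ ^ 2 < 1) :
    (∀ (v : H) (ξ : ℕ → H) (η : ℕ → ∀ i, G i),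
      (∀ j, IsInnerStep g h B w γ σ τ v (ξ j) (η j) (ξ (j + 1)) (η (j + 1))) →
      (∃ p q, innerGap g h B w γ v p q = 0) →
        ∃ p q, innerGap g h B w γ v p q = 0 ∧
          Tendsto ξ atTop (𝓝 p) ∧ Tendsto η atTop (𝓝 q)) ∧
    (∀ (ε : ℕ → ℝ), (∀ k, 0 ≤ ε k) → (Summable fun k => Real.sqrt (ε k)) →
      ∀ (x0 xb0 : H) (y0 : ∀ i, G i)
        (x u : ℕ → H) (xb : ℕ → ℕ → H) (y : ℕ → ℕ → ∀ i, G i),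
        IsPrimalDualFBRun f g h B w γ σ τ ε x0 xb0 y0 x u xb y →
          ∃ z, IsCompositeSolution f g h B z ∧ Tendsto x atTop (𝓝 z)) := by
  refine ⟨fun v ξ η hstep hgap =>
    exists_tendsto_innerGap_eq_zero hg hh hw hγ hσ hτ hστ hstep hgap, ?_⟩
  intro ε hε hsum x0 xb0 y0 x u xb y hrun
  obtain ⟨z₀, hz₀⟩ := hsol
  rw [isCompositeSolution_iff hg hh] at hz₀
  have hΦ := isGammaZero_compositePenalty hg hh ⟨z₀, hz₀.1⟩
  have hfix := (isProx_gradient_step_iff hf_convex hf_diff hΦ hγ).2 hz₀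
  obtain ⟨z, hz, hlim⟩ := exists_tendsto_of_inexact_forwardBackward hf_convex hf_diff hL hf_lip hΦ
    hγ hγL hfix (x := x) (e := fun k => √2 * √(ε k)) (fun k => by positivity)
    (hsum.mul_left _) fun k p hp => by
      rw [← hrun.gradient_step k] at hp
      rcases hrun.output k with ⟨j, hj, hxj⟩ | hj
      · rw [hxj, ← Real.sqrt_mul zero_le_two]
        exact Real.le_sqrt_of_sq_le (norm_sub_sq_le_of_innerGap_le hg hh hγ hj.le hp)
      -- Firm nonexpansiveness with equal inputs is uniqueness of the proximal point, so the error
      -- is zero.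
      · have h1 := (isProx_of_tendsto_inner hg hh hw hγ hσ hτ hστ
          (hrun.inner_step k) hj).norm_sub_sq_le_inner hγ hΦ hp
        rw [sub_self, inner_zero_left] at h1
        rw [pow_eq_zero_iff two_ne_zero |>.1 (le_antisymm h1 (sq_nonneg _))]
        positivity
  exact ⟨z, (isCompositeSolution_iff hg hh).2
    ((isProx_gradient_step_iff hf_convex hf_diff hΦ hγ).1 hz), hlim⟩
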